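/- Consider a preemptive last-come first-served (LCFS) GI/GI/1 queue: packets arrive with i.i.d. non-negative interarrival times distributed as $G$, with $0<\mathrm{E}[G]<\infty$; their service times are i.i.d., distributed as a non-negative $H$ with $\mathrm{E}[H]<\infty$, and independent of the interarrival times; every arriving packet starts service at once, interrupting the service in progress, if any, so that a packet updates the monitor, at its service completion, unless the next packet arrives before that completion. The state of the system at time $0$ is arbitrary. The age of information (AoI) at time $t$ is $A_t=t-\eta_t$, where $\eta_t$ is the arrival time of the freshest packet received by the monitor by time $t$. The stationary AoI is a random variable $A$ whose distribution function is the long-run fraction of time in which the AoI is at most $x$: with probability one, $\Pr(A\le x)=\lim_{T\to\infty}\frac1T\int_0^T \mathbf 1_{\{A_t\le x\}}\,\mathrm{d}t$ for all $x$. For random variables with finite means $\mathrm{E}[X]=\mathrm{E}[Y]$, write $X\le_{\mathrm{cx}}Y$ if $\mathrm{E}[\phi(X)]\le \mathrm{E}[\phi(Y)]$ for all convex functions $\phi$ for which the expectations exist. Write $X\le_{\mathrm{st}}Y$ if $\mathrm{E}[\phi(X)]\le \mathrm{E}[\phi(Y)]$ for all non-decreasing functions $\phi$ for which the expectations exist.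 Consider two such queues, $k=1,2$, with the same mean interarrival time, $\mathrm{E}[G^{\langle 1\rangle}]=\mathrm{E}[G^{\langle 2\rangle}]$, and the same mean service time, $\mathrm{E}[H^{\langle 1\rangle}]=\mathrm{E}[H^{\langle 2\rangle}]$, and let $A^{\langle k\rangle}$ be the stationary AoI of the $k$th queue. (i) If both are M/GI/1 queues (exponential interarrival times), then $H^{\langle 1\rangle}\le_{\mathrm{cx}}H^{\langle 2\rangle}$ implies that the stationary AoIs $A^{\langle 1\rangle}$ and $A^{\langle 2\rangle}$ exist, have finite means, and satisfy $\mathrm{E}[A^{\langle 1\rangle}]\ge \mathrm{E}[A^{\langle 2\rangle}]$. (ii) If both are GI/M/1 queues (exponential service times), then $G^{\langle 1\rangle}\le_{\mathrm{cx}}G^{\langle 2\rangle}$ implies that the stationary AoIs $A^{\langle 1\rangle}$ and $A^{\langle 2\rangle}$ exist and satisfy $A^{\langle 1\rangle}\le_{\mathrm{st}}A^{\langle 2\rangle}$. -/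

import Mathlib

open MeasureTheory ProbabilityTheory Filter Topology

/-- `μ ≤_cx ν`: two laws on `ℝ` with the same finite mean, such that the expectation of every
convex function of the first is at most that of the second, provided the expectations exist. -/
def ConvexLE (μ ν : Measure ℝ) : Prop :=
  Integrable (fun x : ℝ => x) μ ∧ Integrable (fun x : ℝ => x) ν ∧
    ∫ x, x ∂μ = ∫ x, x ∂ν ∧
    ∀ φ : ℝ → ℝ, ConvexOn ℝ Set.univ φ → Integrable φ μ → Integrable φ ν →
      ∫ x, φ x ∂μ ≤ ∫ x, φ x ∂ν

/-- `μ ≤_st ν`: the usual stochastic order of laws on `ℝ`, that is, the expectation of every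
non-decreasing function of the first is at most that of the second, provided the expectations
exist. -/
def StochLE (μ ν : Measure ℝ) : Prop :=
  ∀ φ : ℝ → ℝ, Monotone φ → Integrable φ μ → Integrable φ ν → ∫ x, φ x ∂μ ≤ ∫ x, φ x ∂ν

/-- `μ` is an exponential distribution (of some positive rate). -/
def IsExponential (μ : Measure ℝ) : Prop :=
  ∃ r : ℝ, 0 < r ∧ μ = expMeasure r

/-- The primitive data of a preemptive last-come first-served GI/GI/1 queue, observed from time `0`
on, whose interarrival times have law `γ` and whose service times have law `η`.

The interarrival times `G n` (between packets `n` and `n + 1`) and the service times `H n`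
(of packet `n`) are non-negative with finite means, i.i.d., and independent of each other; the
mean interarrival time is positive. The state at time `0` is arbitrary: `firstArrival` is the time
of the first arrival, `initStamp` is the time-stamp displayed at time `0`, and a packet with
time-stamp `oldStamp` may be in service, with residual service time `oldService` (the choice
`oldStamp = initStamp` describes an idle server). -/
structure PreemptiveLCFS {Ω : Type*} [MeasurableSpace Ω] (P : Measure Ω) (γ η : Measure ℝ) where
  /-- interarrival time between packets `n` and `n + 1` -/
  G : ℕ → Ω → ℝ
  /-- service time of packet `n` -/
  H : ℕ → Ω → ℝ
  /-- arrival time of packet `0` -/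
  firstArrival : Ω → ℝ
  /-- time-stamp of the information displayed at time `0` -/
  initStamp : Ω → ℝ
  /-- time-stamp of the packet in service at time `0` -/
  oldStamp : Ω → ℝ
  /-- residual service time of the packet in service at time `0` -/
  oldService : Ω → ℝ
  hasLaw_G : ∀ n, HasLaw (G n) γ P
  hasLaw_H : ∀ n, HasLaw (H n) η P
  iIndepFun_G_H : iIndepFun (Sum.elim G H : ℕ ⊕ ℕ → Ω → ℝ) P
  nonneg_G : ∀ᵐ x ∂γ, 0 ≤ x
  nonneg_H : ∀ᵐ x ∂η, 0 ≤ x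
  integrable_G : Integrable (fun x : ℝ => x) γ
  integrable_H : Integrable (fun x : ℝ => x) η
  mean_G_pos : 0 < ∫ x, x ∂γ
  aemeasurable_firstArrival : AEMeasurable firstArrival P
  aemeasurable_initStamp : AEMeasurable initStamp P
  aemeasurable_oldStamp : AEMeasurable oldStamp P
  aemeasurable_oldService : AEMeasurable oldService P
  firstArrival_nonneg : ∀ᵐ ω ∂P, 0 ≤ firstArrival ω
  initStamp_nonpos : ∀ᵐ ω ∂P, initStamp ω ≤ 0
  oldStamp_nonpos : ∀ᵐ ω ∂P, oldStamp ω ≤ 0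
  oldService_nonneg : ∀ᵐ ω ∂P, 0 ≤ oldService ω

namespace PreemptiveLCFS

variable {Ω : Type*} [MeasurableSpace Ω] {P : Measure Ω} {γ η : Measure ℝ}

/-- Arrival time, which is also the time-stamp, of packet `n`. -/
noncomputable def arrival (Q : PreemptiveLCFS P γ η) (n : ℕ) (ω : Ω) : ℝ :=
  Q.firstArrival ω + ∑ i ∈ Finset.range n, Q.G i ω

/-- Packet `n` enters service on its arrival and, unless the next packet arrives before its
service is completed, it is delivered to the monitor at that completion. This says that the
delivery takes place by time `t`. -/
def DeliveredBy (Q : PreemptiveLCFS P γ η) (ω : Ω) (n : ℕ) (t : ℝ) : Prop :=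
  Q.H n ω ≤ Q.G n ω ∧ Q.arrival n ω + Q.H n ω ≤ t

/-- The packet that is in service at time `0` is delivered by time `t`. -/
def OldDeliveredBy (Q : PreemptiveLCFS P γ η) (ω : Ω) (t : ℝ) : Prop :=
  Q.oldService ω ≤ Q.firstArrival ω ∧ Q.oldService ω ≤ t

/-- The time-stamps of all the information that the monitor has received by time `t`. -/
def receivedStamps (Q : PreemptiveLCFS P γ η) (ω : Ω) (t : ℝ) : Set ℝ :=
  {u | u = Q.initStamp ω ∨ (Q.OldDeliveredBy ω t ∧ u = Q.oldStamp ω) ∨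
    ∃ n, Q.DeliveredBy ω n t ∧ u = Q.arrival n ω}

/-- The time-stamp of the information displayed at time `t`: the latest one received. -/
noncomputable def displayedStamp (Q : PreemptiveLCFS P γ η) (ω : Ω) (t : ℝ) : ℝ :=
  sSup (Q.receivedStamps ω t)

/-- The age of information at time `t`. -/
noncomputable def aoi (Q : PreemptiveLCFS P γ η) (ω : Ω) (t : ℝ) : ℝ :=
  t - Q.displayedStamp ω t

/-- `ν` is the stationary distribution of the age of information: almost surely, for every `x`,
the long-run fraction of time in which the age is at most `x` is `ν (-∞, x]`. -/
def IsStationaryAoI (Q : PreemptiveLCFS P γ η) (ν : Measure ℝ) : Prop :=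
  IsProbabilityMeasure ν ∧
    ∀ᵐ ω ∂P, ∀ x : ℝ,
      Tendsto
        (fun T : ℝ => T⁻¹ * ∫ t in (0 : ℝ)..T, {s | Q.aoi ω s ≤ x}.indicator (fun _ => (1 : ℝ)) t)
        atTop (𝓝 (ν.real (Set.Iic x)))

end PreemptiveLCFS

/-! Let B be the age just before an arrival. A delivered packet (H ≤ G) resets the age and an
interrupted one does not, so from the first delivery on the successive values satisfy B' = G + 1{H >
G} B. If P(H ≤ G) > 0, this recursion forgets its starting point geometrically fast. Its stationary
law β (`stationaryArrivalAge`) is a series over the number k of interruptions in a row since the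
last delivery. Between two arrivals the age is a sawtooth determined by B, H and the elapsed time u,
so the renewal-reward principle gives the law of the age: ν(f) = E[∫₀^G f(sawtooth(B, H, u)) du] /
E[G], with B of law β independent of (G, H) (`stationaryAge`, `isStationaryAoI_stationaryAge`).

The almost sure convergence rests on the ordinary strong law. The chain restarted from 0 some m
packets earlier depends on a finite window of the i.i.d. input, never exceeds the true age, and
agrees with it unless all m packets were interrupted. This sandwiches the true averages between
averages over finite windows, with a gap of mean E[G] P(H > G)^m.

(i) With exponential interarrival times of rate r, the law of elapsed time in an interval is again
exponential, so ν = β. Taking means in the recursion gives E[B] = E[G] / P(H ≤ G) = r⁻¹ /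
E[exp(-rH)]. Since exp(-rx) is convex, more variable service increases the denominator and lowers
the mean age.

(ii) With exponential service of rate r, let v be the tail of β. It satisfies a renewal equation
whose kernel carries the factor exp(-rG). Multiplying by exp(rs) and integrating over s ≤ x turns
the kernel into a pure translation, and the unknown part cancels against that of the formula for the
tail of ν. What remains is E[G] ν(x, ∞) = E[w(G)] for x ≥ 0, where w(g) = exp(-rx)(exp(r min(x, g))
- 1)/r + (g - x)⁺ (`timeAboveMean`). As w is convex, the convex order of the interarrival laws
orders all tails of ν, which is the stochastic order. -/

open scoped ENNReal

/-! ### Limits of averages of real sequences -/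

/-- Renewal-reward interpolation: a monotone `F` whose values along `c n ∼ a n` grow like `b n`
grows like `(b / a) T`. -/
theorem tendsto_inv_mul_of_monotone {F : ℝ → ℝ} (hF : Monotone F) {c : ℕ → ℝ} {a b : ℝ}
    (ha : 0 < a) (hc : Tendsto (fun n : ℕ => c n / n) atTop (𝓝 a))
    (hFc : Tendsto (fun n : ℕ => F (c n) / n) atTop (𝓝 b)) :
    Tendsto (fun T : ℝ => T⁻¹ * F T) atTop (𝓝 (b / a)) := by
  -- The index n = ⌈θT/a⌉ has c n > (a/θ) n ≥ T for large T, so F T ≤ F (c n). The slack θ > 1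
  -- absorbs the error in c n ∼ a n; the lower bound uses ⌊T/(aθ)⌋ in the same way, and finally θ ↓
  -- 1.
  have upper : ∀ θ : ℝ, 1 < θ → ∃ f : ℝ → ℝ, Tendsto f atTop (𝓝 (b * (θ / a))) ∧
      ∀ᶠ T in atTop, T⁻¹ * F T ≤ f T := by
    intro θ hθ
    have hn : Tendsto (fun T : ℝ => ⌈θ / a * T⌉₊) atTop atTop :=
      tendsto_nat_ceil_atTop.comp (tendsto_id.const_mul_atTop (by positivity))
    refine ⟨fun T => F (c ⌈θ / a * T⌉₊) / (⌈θ / a * T⌉₊ : ℝ) * ((⌈θ / a * T⌉₊ : ℝ) / T), ?_, ?_⟩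
    · exact (hFc.comp hn).mul (tendsto_nat_ceil_mul_div_atTop (by positivity))
    · have h1 : ∀ᶠ n : ℕ in atTop, a / θ < c n / n :=
        hc.eventually (lt_mem_nhds (div_lt_self ha hθ))
      filter_upwards [hn.eventually h1, eventually_gt_atTop 0] with T hT hT0
      have hpos : (0 : ℝ) < (⌈θ / a * T⌉₊ : ℝ) := by
        exact_mod_cast Nat.ceil_pos.2 (by positivity)
      rw [lt_div_iff₀ hpos] at hT
      have h2 : T ≤ c ⌈θ / a * T⌉₊ := by
        refine le_trans ?_ hT.le
        calc T = a / θ * (θ / a * T) := by field_simp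
          _ ≤ _ := by gcongr; exact Nat.le_ceil _
      rw [div_mul_div_cancel₀ hpos.ne', inv_mul_eq_div]
      gcongr
      exact hF h2
  have lower : ∀ θ : ℝ, 1 < θ → ∃ f : ℝ → ℝ, Tendsto f atTop (𝓝 (b * (1 / (a * θ)))) ∧
      ∀ᶠ T in atTop, f T ≤ T⁻¹ * F T := by
    intro θ hθ
    have hn : Tendsto (fun T : ℝ => ⌊1 / (a * θ) * T⌋₊) atTop atTop :=
      tendsto_nat_floor_atTop.comp (tendsto_id.const_mul_atTop (by positivity))
    refine ⟨fun T => F (c ⌊1 / (a * θ) * T⌋₊) / (⌊1 / (a * θ) * T⌋₊ : ℝ) *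
      ((⌊1 / (a * θ) * T⌋₊ : ℝ) / T), ?_, ?_⟩
    · exact (hFc.comp hn).mul (tendsto_nat_floor_mul_div_atTop (by positivity))
    · have h1 : ∀ᶠ n : ℕ in atTop, c n / n < a * θ :=
        hc.eventually (gt_mem_nhds (by nlinarith))
      filter_upwards [hn.eventually h1, hn.eventually (eventually_gt_atTop 0),
        eventually_gt_atTop 0] with T hT hpos' hT0
      have hpos : (0 : ℝ) < (⌊1 / (a * θ) * T⌋₊ : ℝ) := by exact_mod_cast hpos'
      rw [div_lt_iff₀ hpos] at hT
      have h2 : c ⌊1 / (a * θ) * T⌋₊ ≤ T := by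
        refine hT.le.trans ?_
        calc _ ≤ a * θ * (1 / (a * θ) * T) := by
              gcongr; exact Nat.floor_le (by positivity)
          _ = T := by field_simp
      rw [div_mul_div_cancel₀ hpos.ne', inv_mul_eq_div]
      gcongr
      exact hF h2
  have hlim : Tendsto (fun θ : ℝ => b * (θ / a)) (𝓝[>] 1) (𝓝 (b / a)) := by
    have : ContinuousAt (fun θ : ℝ => b * (θ / a)) 1 := by fun_prop
    simpa [div_eq_mul_inv] using this.tendsto.mono_left nhdsWithin_le_nhds
  have hlim' : Tendsto (fun θ : ℝ => b * (1 / (a * θ))) (𝓝[>] 1) (𝓝 (b / a)) := by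
    have : ContinuousAt (fun θ : ℝ => b * (1 / (a * θ))) 1 := by
      have : a * (1 : ℝ) ≠ 0 := by positivity
      fun_prop (disch := assumption)
    simpa [div_eq_mul_inv] using this.tendsto.mono_left nhdsWithin_le_nhds
  refine tendsto_order.2 ⟨fun l hl => ?_, fun l hl => ?_⟩
  · obtain ⟨θ, hθl, hθ⟩ :=
      ((hlim'.eventually (lt_mem_nhds hl)).and self_mem_nhdsWithin).exists
    obtain ⟨f, hf, hfF⟩ := lower θ hθ
    filter_upwards [hf.eventually (lt_mem_nhds hθl), hfF] with T h1 h2 using h1.trans_le h2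
  · obtain ⟨θ, hθl, hθ⟩ :=
      ((hlim.eventually (gt_mem_nhds hl)).and self_mem_nhdsWithin).exists
    obtain ⟨f, hf, hfF⟩ := upper θ hθ
    filter_upwards [hf.eventually (gt_mem_nhds hθl), hfF] with T h1 h2 using h2.trans_lt h1

theorem sum_range_mul_eq_sum_residues (Y : ℕ → ℝ) (M K : ℕ) :
    ∑ n ∈ Finset.range (K * M), Y n =
      ∑ r ∈ Finset.range M, ∑ j ∈ Finset.range K, Y (r + j * M) := by
  induction K with
  | zero => simp
  | succ K ih =>
    rw [Nat.succ_mul, Finset.sum_range_add, ih, ← Finset.sum_add_distrib]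
    refine Finset.sum_congr rfl fun r _ => ?_
    rw [Finset.sum_range_succ, add_comm (K * M) r]

/-- If the averages of a non-negative sequence along every residue class modulo `M` converge to
`e`, then so do its averages. -/
theorem tendsto_average_of_residues {Y : ℕ → ℝ} (hY : ∀ n, 0 ≤ Y n) {M : ℕ} (hM : 0 < M) {e : ℝ}
    (h : ∀ r < M, Tendsto (fun K : ℕ => (∑ j ∈ Finset.range K, Y (r + j * M)) / K) atTop (𝓝 e)) :
    Tendsto (fun N : ℕ => (∑ n ∈ Finset.range N, Y n) / N) atTop (𝓝 e) := by
  have hmono : Monotone fun T : ℝ => ∑ n ∈ Finset.range ⌊T⌋₊, Y n := fun s t hst =>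
    Finset.sum_le_sum_of_subset_of_nonneg
      (Finset.range_subset_range.2 (Nat.floor_mono hst)) fun i _ _ => hY i
  have hM' : (0 : ℝ) < M := by exact_mod_cast hM
  have hc : Tendsto (fun K : ℕ => (((K * M : ℕ) : ℝ)) / K) atTop (𝓝 (M : ℝ)) := by
    refine tendsto_const_nhds.congr' ?_
    filter_upwards [eventually_gt_atTop 0] with K hK
    have : (K : ℝ) ≠ 0 := by exact_mod_cast hK.ne'
    push_cast
    field_simp
  have hF : Tendsto (fun K : ℕ => (∑ n ∈ Finset.range ⌊((K * M : ℕ) : ℝ)⌋₊, Y n) / K) atTop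
      (𝓝 (M * e)) := by
    have := tendsto_finsetSum (Finset.range M) (fun r hr => h r (Finset.mem_range.1 hr))
    simp only [Finset.sum_const, Finset.card_range, nsmul_eq_mul] at this
    refine this.congr fun K => ?_
    rw [Nat.floor_natCast, sum_range_mul_eq_sum_residues, Finset.sum_div]
  have := (tendsto_inv_mul_of_monotone hmono hM' hc hF).comp tendsto_natCast_atTop_atTop
  rw [mul_div_cancel_left₀ _ hM'.ne'] at this
  refine this.congr fun N => ?_
  simp [div_eq_inv_mul]

/-- A sequence sandwiched, up to a shift, between sequences whose averages have limits arbitrarily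
close to `c` has averages converging to `c`. -/
theorem tendsto_average_of_sandwich {a : ℕ → ℝ} {l u : ℕ → ℕ → ℝ} {cl cu : ℕ → ℝ} {c : ℝ}
    (hl : ∀ m n, l m n ≤ a (n + m)) (hu : ∀ m n, a (n + m) ≤ u m n)
    (hla : ∀ m, Tendsto (fun N : ℕ => (∑ n ∈ Finset.range N, l m n) / N) atTop (𝓝 (cl m)))
    (hua : ∀ m, Tendsto (fun N : ℕ => (∑ n ∈ Finset.range N, u m n) / N) atTop (𝓝 (cu m)))
    (hcl : Tendsto cl atTop (𝓝 c)) (hcu : Tendsto cu atTop (𝓝 c)) :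
    Tendsto (fun N : ℕ => (∑ n ∈ Finset.range N, a n) / N) atTop (𝓝 c) := by
  -- For fixed m, the first m terms and the change of normalisation from N to N + m are negligible
  -- in the limit.
  have key : ∀ (m : ℕ) (e : ℝ) (z : ℕ → ℝ),
      Tendsto (fun N : ℕ => (∑ n ∈ Finset.range N, z n) / N) atTop (𝓝 e) →
      Tendsto (fun N : ℕ => (∑ n ∈ Finset.range m, a n) / ((N + m : ℕ) : ℝ) +
        (∑ n ∈ Finset.range N, z n) / N * ((N : ℝ) / ((N + m : ℕ) : ℝ))) atTop (𝓝 e) := by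
    intro m e z hz
    have h1 : Tendsto (fun N : ℕ => (∑ n ∈ Finset.range m, a n) / ((N + m : ℕ) : ℝ)) atTop
        (𝓝 0) :=
      (tendsto_const_div_atTop_nhds_zero_nat _).comp (tendsto_add_atTop_nat m)
    have h2 : Tendsto (fun N : ℕ => (N : ℝ) / ((N + m : ℕ) : ℝ)) atTop (𝓝 1) := by
      simpa using tendsto_natCast_div_add_atTop (m : ℝ)
    simpa using h1.add (hz.mul h2)
  have split : ∀ m N : ℕ, 0 < N → (∑ n ∈ Finset.range (N + m), a n) / ((N + m : ℕ) : ℝ) =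
      (∑ n ∈ Finset.range m, a n) / ((N + m : ℕ) : ℝ) +
        (∑ n ∈ Finset.range N, a (n + m)) / N * ((N : ℝ) / ((N + m : ℕ) : ℝ)) := by
    intro m N hN
    have : (N : ℝ) ≠ 0 := by exact_mod_cast hN.ne'
    rw [div_mul_div_cancel₀ this, ← add_div, add_comm N m, Finset.sum_range_add]
    simp_rw [add_comm m]
  refine tendsto_order.2 ⟨fun x hx => ?_, fun x hx => ?_⟩
  · obtain ⟨m, hm⟩ := (hcl.eventually (lt_mem_nhds hx)).exists
    rw [← map_add_atTop_eq_nat m, eventually_map]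
    filter_upwards [(key m _ _ (hla m)).eventually (lt_mem_nhds hm), eventually_gt_atTop 0]
      with N h1 h2
    rw [split m N h2]
    refine h1.trans_le ?_
    gcongr
    exact hl m _
  · obtain ⟨m, hm⟩ := (hcu.eventually (gt_mem_nhds hx)).exists
    rw [← map_add_atTop_eq_nat m, eventually_map]
    filter_upwards [(key m _ _ (hua m)).eventually (gt_mem_nhds hm), eventually_gt_atTop 0]
      with N h1 h2
    rw [split m N h2]
    refine lt_of_le_of_lt ?_ h1
    gcongr
    exact hu m _

/-! ### Strong law for functions of a finite window of i.i.d. variables -/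

section MDependent

variable {E : Type*} [MeasurableSpace E]

theorem map_shift_infinitePi (ρ : Measure E) [IsProbabilityMeasure ρ] (n : ℕ) :
    (Measure.infinitePi fun _ : ℕ => ρ).map (fun p i => p (n + i)) =
      Measure.infinitePi fun _ : ℕ => ρ :=
  Measure.map_infinitePi_infinitePi_of_inj (P := fun _ : ℕ => ρ) (add_right_injective n)

/-- Each function factors measurably through the coordinates it depends on: the remaining
coordinates can be filled with a fixed point `e`. Independence of disjoint blocks of coordinates
then transfers. -/
theorem indepFun_infinitePi_of_dependsOn (ρ : Measure E) [IsProbabilityMeasure ρ]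
    {F F' : Type*} [MeasurableSpace F] [MeasurableSpace F']
    {f : (ℕ → E) → F} {g : (ℕ → E) → F'} (hf : Measurable f) (hg : Measurable g) {S T : Finset ℕ}
    (hfS : DependsOn f S) (hgT : DependsOn g T) (hST : Disjoint S T) :
    IndepFun f g (Measure.infinitePi fun _ : ℕ => ρ) := by
  obtain ⟨e⟩ : Nonempty E := nonempty_of_isProbabilityMeasure ρ
  have hind : iIndepFun (fun (i : ℕ) (p : ℕ → E) => p i) (Measure.infinitePi fun _ : ℕ => ρ) :=
    iIndepFun_infinitePi (X := fun _ => id) fun _ => measurable_id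
  have h := hind.indepFun_finset S T hST fun i => measurable_pi_apply i
  classical
  let ext : ∀ U : Finset ℕ, (U → E) → ℕ → E := fun U q i => if hi : i ∈ U then q ⟨i, hi⟩ else e
  have ext_meas : ∀ U : Finset ℕ, Measurable (ext U) := by
    intro U
    refine measurable_pi_lambda _ fun i => ?_
    by_cases hi : i ∈ U
    · simpa [ext, hi] using measurable_pi_apply _
    · simp [ext, hi]
  have ext_restrict : ∀ (U : Finset ℕ) (p : ℕ → E), ∀ i ∈ U, p i = ext U (fun j => p j) i := by
    intro U p i hi
    simp [ext, hi]
  rw [show f = (f ∘ ext S) ∘ fun p (i : S) => p i from funext fun p => hfS (ext_restrict S p),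
    show g = (g ∘ ext T) ∘ fun p (i : T) => p i from funext fun p => hgT (ext_restrict T p)]
  exact h.comp (hf.comp (ext_meas S)) (hg.comp (ext_meas T))

/-- Strong law of large numbers for a non-negative function of finitely many successive terms of an
i.i.d. sequence. -/
theorem strong_law_finite_window (ρ : Measure E) [IsProbabilityMeasure ρ]
    {f : (ℕ → E) → ℝ} (hf : Measurable f) (hf0 : ∀ p, 0 ≤ f p) {M : ℕ}
    (hfM : DependsOn f (Finset.range M)) (hint : Integrable f (Measure.infinitePi fun _ : ℕ => ρ)) :
    ∀ᵐ p ∂(Measure.infinitePi fun _ : ℕ => ρ),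
      Tendsto (fun N : ℕ => (∑ n ∈ Finset.range N, f fun i => p (n + i)) / N) atTop
        (𝓝 (∫ p, f p ∂(Measure.infinitePi fun _ : ℕ => ρ))) := by
  set Pr := Measure.infinitePi fun _ : ℕ => ρ with hPr
  have hsh : ∀ n : ℕ, Measurable fun (p : ℕ → E) (i : ℕ) => p (n + i) := fun n => by fun_prop
  have hident : ∀ n, IdentDistrib (fun p => f fun i => p (n + i)) f Pr Pr := fun n =>
    ⟨(hf.comp (hsh n)).aemeasurable, hf.aemeasurable, by
      rw [show (fun p : ℕ → E => f fun i => p (n + i)) = f ∘ fun p i => p (n + i) from rfl,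
        ← Measure.map_map hf (hsh n), hPr, map_shift_infinitePi]⟩
  -- Windows of length M + 1 rather than M keep the modulus positive when M = 0.
  have hdep : ∀ n, DependsOn (fun p : ℕ → E => f fun i => p (n + i)) (Finset.Ico n (n + (M + 1))) :=
    fun n p q hpq => hfM fun i hi => hpq _ (by simp at hi ⊢; omega)
  -- Along a residue class modulo M + 1 the windows are disjoint, so the terms are pairwise
  -- independent and identically distributed, which is all the strong law needs.
  have main : ∀ r : ℕ, ∀ᵐ p ∂Pr, Tendsto (fun K : ℕ =>
      (∑ j ∈ Finset.range K, f fun i => p (r + j * (M + 1) + i)) / K) atTop (𝓝 (∫ p, f p ∂Pr)) := by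
    intro r
    have := strong_law_ae_real (μ := Pr) (fun j p => f fun i => p (r + j * (M + 1) + i))
      ((hident _).symm.integrable_snd hint) ?_ fun j => (hident _).trans (hident _).symm
    · have he := (hident (r + 0 * (M + 1))).integral_eq
      rwa [he] at this
    · have aux : ∀ j k : ℕ, j < k → IndepFun (fun p => f fun i => p (r + j * (M + 1) + i))
          (fun p => f fun i => p (r + k * (M + 1) + i)) Pr := by
        intro j k hjk
        refine indepFun_infinitePi_of_dependsOn ρ (hf.comp (hsh _)) (hf.comp (hsh _))
          (hdep _) (hdep _) ?_
        rw [Finset.disjoint_left]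
        intro i hi hi'
        rw [Finset.mem_Ico] at hi hi'
        have : (j + 1) * (M + 1) ≤ k * (M + 1) := Nat.mul_le_mul_right _ hjk
        have h2 : (j + 1) * (M + 1) = j * (M + 1) + (M + 1) := by ring
        omega
      intro j k hjk
      rcases lt_or_gt_of_ne hjk with h | h
      · exact aux j k h
      · exact (aux k j h).symm
  filter_upwards [ae_all_iff.2 main] with p hp
  exact tendsto_average_of_residues (fun n => hf0 _) (Nat.succ_pos M) fun r _ => hp r

end MDependent

/-! ### The recursion for the age at arrivals and its stationary law -/

/-- An i.i.d. sequence of independent pairs, from two independent i.i.d. sequences. -/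
theorem hasLaw_prodMk_infinitePi {Ω : Type*} [MeasurableSpace Ω] {P : Measure Ω}
    {γ η : Measure ℝ} [IsProbabilityMeasure γ] [IsProbabilityMeasure η] {G H : ℕ → Ω → ℝ}
    (hG : ∀ n, HasLaw (G n) γ P) (hH : ∀ n, HasLaw (H n) η P)
    (hGH : iIndepFun (Sum.elim G H : ℕ ⊕ ℕ → Ω → ℝ) P) :
    HasLaw (fun ω n => (G n ω, H n ω)) (Measure.infinitePi fun _ : ℕ => γ.prod η) P := by
  let g : ℕ × Bool → ℕ ⊕ ℕ := fun i => if i.2 then .inr i.1 else .inl i.1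
  have hg : Function.Injective g := by
    rintro ⟨a, _ | _⟩ ⟨b, _ | _⟩ h <;> simp [g] at h <;> simp [h]
  let law : Bool → Measure ℝ := fun i => if i then η else γ
  have : ∀ i, IsProbabilityMeasure (law i) := by
    rintro (_ | _) <;> simp only [law] <;> infer_instance
  have hlaw : ∀ i : ℕ × Bool, HasLaw (Sum.elim G H (g i)) (law i.2) P := by
    rintro ⟨a, _ | _⟩
    · exact hG a
    · exact hH a
  have h1 : HasLaw (fun ω i => Sum.elim G H (g i) ω)
      (Measure.infinitePi fun i : ℕ × Bool => law i.2) P :=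
    (hGH.precomp hg).hasLaw_infinitePi hlaw (aemeasurable_pi_iff.2 fun i => (hlaw i).aemeasurable)
  let pair : (Bool → ℝ) → ℝ × ℝ := fun q => (q false, q true)
  have hpair : Measurable pair := by fun_prop
  have hpairs : Measurable fun (q : ℕ × Bool → ℝ) n => pair fun b => q (n, b) := by
    simp only [pair]; fun_prop
  have h2 : (Measure.infinitePi fun i : ℕ × Bool => law i.2).map
      (fun q n => pair fun b => q (n, b)) = Measure.infinitePi fun _ : ℕ => γ.prod η := by
    have hc := Measure.infinitePi_map_curry (ι := ℕ) (κ := Bool) (fun _ b => law b)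
    have hp : (Measure.infinitePi law).map pair = γ.prod η :=
      Measure.infinitePi_map_eval_prod (P := law) Bool.false_ne_true
    have hpi := Measure.infinitePi_map_pi (μ := fun _ : ℕ => Measure.infinitePi law)
      (f := fun _ => pair) fun _ => hpair
    rw [hp] at hpi
    rw [← hpi, ← hc, Measure.map_map (by fun_prop) (by fun_prop)]
    rfl
  refine ⟨aemeasurable_pi_iff.2 fun n => (hG n).aemeasurable.prodMk (hH n).aemeasurable, ?_⟩
  rw [← h2, ← h1.map_eq, AEMeasurable.map_map_of_aemeasurable hpairs.aemeasurable h1.aemeasurable]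
  rfl

/-- The age, just before the next arrival, of the freshest information delivered, when it was `b`
just before the present arrival and `p` consists of the interarrival and the service times. -/
noncomputable def ageStep (b : ℝ) (p : ℝ × ℝ) : ℝ := p.1 + if p.2 ≤ p.1 then 0 else b

/-- The ages just before the arrivals, started from `0`. -/
noncomputable def ageChain (p : ℕ → ℝ × ℝ) : ℕ → ℝ
  | 0 => 0
  | n + 1 => ageStep (ageChain p n) (p n)

/-- The age `u` time units after an arrival at which it was `b`, for a service time `h`. -/
noncomputable def sawtooth (b h u : ℝ) : ℝ := if h ≤ u then u else b + u

/-- The time spent by the age in `(-∞, x]` between two arrivals. -/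
noncomputable def timeBelow (x b : ℝ) (p : ℝ × ℝ) : ℝ≥0∞ :=
  volume {u | (0 ≤ u ∧ u < p.1) ∧ sawtooth b p.2 u ≤ x}

/-- The interarrival and service times for which the packet is delivered. -/
def deliveredSet : Set (ℝ × ℝ) := {p | p.2 ≤ p.1}

theorem measurableSet_deliveredSet : MeasurableSet deliveredSet :=
  measurableSet_le measurable_snd measurable_fst

/-- The contribution to the stationary law of the age at arrivals of the event that exactly `k`
packets in a row have been interrupted. -/
noncomputable def arrivalAgePart (γ η : Measure ℝ) : ℕ → Measure ℝ
  | 0 => ((γ.prod η).restrict deliveredSet).map Prod.fst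
  | k + 1 => ((arrivalAgePart γ η k).prod ((γ.prod η).restrict deliveredSetᶜ)).map
      fun z => z.1 + z.2.1

/-- The stationary law of the age just before arrivals. -/
noncomputable def stationaryArrivalAge (γ η : Measure ℝ) : Measure ℝ :=
  Measure.sum (arrivalAgePart γ η)

section Step

theorem measurable_ageStep : Measurable fun z : ℝ × ℝ × ℝ => ageStep z.1 z.2 := by
  unfold ageStep
  refine Measurable.add (by fun_prop) (Measurable.ite ?_ measurable_const measurable_fst)
  exact measurableSet_le (by fun_prop) (by fun_prop)

theorem measurable_sawtooth : Measurable fun z : (ℝ × ℝ × ℝ) × ℝ => sawtooth z.1.1 z.1.2.2 z.2 := by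
  unfold sawtooth
  refine Measurable.ite ?_ (by fun_prop) (by fun_prop)
  exact measurableSet_le (by fun_prop) (by fun_prop)

theorem measurable_ageChain (n : ℕ) : Measurable fun p : ℕ → ℝ × ℝ => ageChain p n := by
  induction n with
  | zero => exact measurable_const
  | succ n ih => exact measurable_ageStep.comp (ih.prodMk (measurable_pi_apply n))

theorem ageChain_succ (p : ℕ → ℝ × ℝ) (n : ℕ) :
    ageChain p (n + 1) = ageStep (ageChain p n) (p n) := rfl

theorem ageChain_congr {p q : ℕ → ℝ × ℝ} {n : ℕ} (h : ∀ i < n, p i = q i) :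
    ageChain p n = ageChain q n := by
  induction n with
  | zero => rfl
  | succ n ih => simp only [ageChain, ih fun i hi => h i (hi.trans n.lt_succ_self), h n n.lt_succ_self]

theorem ageChain_nonneg {p : ℕ → ℝ × ℝ} (hp : ∀ n, 0 ≤ (p n).1) (n : ℕ) : 0 ≤ ageChain p n := by
  induction n with
  | zero => exact le_rfl
  | succ n ih =>
    simp only [ageChain, ageStep]
    have := hp n
    split_ifs <;> linarith

/-- `ageStep` is monotone in the previous age, and 0 is the least possible age; restarting from 0
can therefore only underestimate. -/
theorem ageChain_shift_le {p : ℕ → ℝ × ℝ} (hp : ∀ n, 0 ≤ (p n).1) (n m : ℕ) :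
    ageChain (fun i => p (n + i)) m ≤ ageChain p (n + m) := by
  induction m with
  | zero => exact ageChain_nonneg hp n
  | succ m ih =>
    rw [← add_assoc, ageChain_succ, ageChain_succ, ageStep, ageStep]
    split_ifs <;> linarith

/-- A delivery erases the past, so two chains driven by the same packets coincide from the first
common delivery on. -/
theorem ageChain_shift_eq {p : ℕ → ℝ × ℝ} {n m : ℕ} (h : ∃ i < m, p (n + i) ∈ deliveredSet) :
    ageChain (fun i => p (n + i)) m = ageChain p (n + m) := by
  induction m with
  | zero => simp at h
  | succ m ih =>
    rw [← add_assoc, ageChain_succ, ageChain_succ, ageStep, ageStep]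
    by_cases hm : p (n + m) ∈ deliveredSet
    · simp [if_pos (show (p (n + m)).2 ≤ (p (n + m)).1 from hm)]
    · obtain ⟨i, hi, hi'⟩ := h
      rw [ih ⟨i, lt_of_le_of_ne (Nat.lt_succ_iff.1 hi) (by rintro rfl; exact hm hi'), hi'⟩]

theorem sawtooth_le_sawtooth {b b' h u : ℝ} (hb : b ≤ b') : sawtooth b h u ≤ sawtooth b' h u := by
  unfold sawtooth
  split_ifs <;> linarith

theorem timeBelow_anti {x b b' : ℝ} (hb : b ≤ b') (p : ℝ × ℝ) :
    timeBelow x b' p ≤ timeBelow x b p :=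
  measure_mono fun _ hu => ⟨hu.1, (sawtooth_le_sawtooth hb).trans hu.2⟩

theorem timeBelow_le (x b : ℝ) (p : ℝ × ℝ) : timeBelow x b p ≤ ENNReal.ofReal p.1 := by
  calc _ ≤ volume (Set.Ico 0 p.1) := measure_mono fun _ hu => hu.1
    _ = _ := by simp

theorem timeBelow_ne_top (x b : ℝ) (p : ℝ × ℝ) : timeBelow x b p ≠ ∞ :=
  ne_top_of_le_ne_top ENNReal.ofReal_ne_top (timeBelow_le x b p)

theorem measurable_timeBelow (x : ℝ) : Measurable fun z : ℝ × ℝ × ℝ => timeBelow x z.1 z.2 := by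
  have h : MeasurableSet {y : (ℝ × ℝ × ℝ) × ℝ |
      (0 ≤ y.2 ∧ y.2 < y.1.2.1) ∧ sawtooth y.1.1 y.1.2.2 y.2 ≤ x} := by
    refine .inter (.inter ?_ ?_) (measurableSet_le measurable_sawtooth measurable_const)
    · exact measurableSet_le measurable_const measurable_snd
    · exact measurableSet_lt measurable_snd (by fun_prop)
  exact measurable_measure_prodMk_left h

end Step

theorem lintegral_ageStep {γ η : Measure ℝ} (f : ℝ → ℝ≥0∞) (μ : Measure ℝ)
    [IsProbabilityMeasure μ] :
    ∫⁻ b, ∫⁻ p, f (ageStep b p) ∂γ.prod η ∂μ = ∫⁻ p in deliveredSet, f p.1 ∂γ.prod η +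
      ∫⁻ b, ∫⁻ p in deliveredSetᶜ, f (b + p.1) ∂γ.prod η ∂μ := by
  have h : ∀ b, ∫⁻ p, f (ageStep b p) ∂γ.prod η = ∫⁻ p in deliveredSet, f p.1 ∂γ.prod η +
      ∫⁻ p in deliveredSetᶜ, f (b + p.1) ∂γ.prod η := by
    intro b
    rw [← lintegral_add_compl _ measurableSet_deliveredSet]
    congr 1
    · refine setLIntegral_congr_fun measurableSet_deliveredSet fun p hp => ?_
      simp [ageStep, if_pos (show p.2 ≤ p.1 from hp)]
    · refine setLIntegral_congr_fun measurableSet_deliveredSet.compl fun p hp => ?_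
      simp [ageStep, if_neg (show ¬ p.2 ≤ p.1 from hp), add_comm]
  simp_rw [h]
  rw [lintegral_add_left measurable_const]
  simp

section Stationary

variable (γ η : Measure ℝ) [IsProbabilityMeasure γ] [IsProbabilityMeasure η]

instance isFiniteMeasure_arrivalAgePart (k : ℕ) : IsFiniteMeasure (arrivalAgePart γ η k) := by
  induction k with
  | zero => unfold arrivalAgePart; infer_instance
  | succ k ih => unfold arrivalAgePart; infer_instance

instance : SFinite (stationaryArrivalAge γ η) := by
  unfold stationaryArrivalAge; infer_instance

/-- Removing the term k = 0 from the series leaves the image of the whole series under one more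
interrupted packet. Hence the law is invariant under `ageStep`. -/
theorem lintegral_stationaryArrivalAge {f : ℝ → ℝ≥0∞} (hf : Measurable f) :
    ∫⁻ b, f b ∂stationaryArrivalAge γ η = ∫⁻ p in deliveredSet, f p.1 ∂γ.prod η +
      ∫⁻ b, ∫⁻ p in deliveredSetᶜ, f (b + p.1) ∂γ.prod η ∂stationaryArrivalAge γ η := by
  rw [stationaryArrivalAge, lintegral_sum_measure, lintegral_sum_measure,
    tsum_eq_zero_add' ENNReal.summable]
  congr 1
  · rw [arrivalAgePart, lintegral_map hf measurable_fst]
  · refine tsum_congr fun k => ?_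
    rw [arrivalAgePart, lintegral_map hf (by fun_prop), lintegral_prod _ (by fun_prop)]

theorem arrivalAgePart_univ (k : ℕ) : arrivalAgePart γ η k Set.univ =
    (γ.prod η) deliveredSetᶜ ^ k * (γ.prod η) deliveredSet := by
  induction k with
  | zero => rw [arrivalAgePart, Measure.map_apply measurable_fst .univ]; simp
  | succ k ih =>
    rw [arrivalAgePart, Measure.map_apply (by fun_prop) .univ, Set.preimage_univ,
      ← Set.univ_prod_univ, Measure.prod_prod, ih, Measure.restrict_apply_univ]
    ring

variable {γ η}

theorem isProbabilityMeasure_stationaryArrivalAge (h : (γ.prod η) deliveredSet ≠ 0) :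
    IsProbabilityMeasure (stationaryArrivalAge γ η) := by
  constructor
  rw [stationaryArrivalAge, Measure.sum_apply _ .univ]
  simp_rw [arrivalAgePart_univ]
  rw [ENNReal.tsum_mul_right, ENNReal.tsum_geometric, prob_compl_eq_one_sub
    measurableSet_deliveredSet, ENNReal.sub_sub_cancel ENNReal.one_ne_top prob_le_one]
  exact ENNReal.inv_mul_cancel h (measure_ne_top _ _)

/-- The age before packet m is a function of the packets before m, hence independent of packet m. -/
theorem lintegral_ageChain {F : ℝ × ℝ × ℝ → ℝ≥0∞} (hF : Measurable F) (m : ℕ) :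
    ∫⁻ p, F (ageChain p m, p m) ∂(Measure.infinitePi fun _ : ℕ => γ.prod η) =
      ∫⁻ p, ∫⁻ q, F (ageChain p m, q) ∂γ.prod η ∂(Measure.infinitePi fun _ : ℕ => γ.prod η) := by
  have hind : IndepFun (fun p => ageChain p m) (fun p => p m)
      (Measure.infinitePi fun _ : ℕ => γ.prod η) :=
    indepFun_infinitePi_of_dependsOn (S := Finset.range m) (T := {m}) _ (measurable_ageChain m)
      (measurable_pi_apply m) (fun p q h => ageChain_congr fun i hi => h i (by simpa using hi))
      (fun p q h => h m (by simp)) (by simp)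
  have hmap := hind.map_prod_eq_prod_map_map (measurable_ageChain m).aemeasurable
    (measurable_pi_apply m).aemeasurable
  rw [Measure.infinitePi_map_eval] at hmap
  rw [← lintegral_map (f := F) hF ((measurable_ageChain m).prodMk (measurable_pi_apply m)), hmap,
    lintegral_prod _ hF.aemeasurable,
    lintegral_map hF.lintegral_prod_right' (measurable_ageChain m)]

/-- The law of the age before packet `m`, started from `0`, differs from the stationary one by
at most the probability that `m` packets in a row are interrupted. -/
theorem lintegral_ageChain_near (h : (γ.prod η) deliveredSet ≠ 0) (m : ℕ) :
    ∀ {r : ℝ → ℝ≥0∞}, Measurable r → ∀ {R : ℝ≥0∞}, (∀ b, r b ≤ R) →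
    ∫⁻ p, r (ageChain p m) ∂(Measure.infinitePi fun _ : ℕ => γ.prod η) ≤
        ∫⁻ b, r b ∂stationaryArrivalAge γ η + R * (γ.prod η) deliveredSetᶜ ^ m ∧
      ∫⁻ b, r b ∂stationaryArrivalAge γ η ≤
        ∫⁻ p, r (ageChain p m) ∂(Measure.infinitePi fun _ : ℕ => γ.prod η) +
          R * (γ.prod η) deliveredSetᶜ ^ m := by
  have := isProbabilityMeasure_stationaryArrivalAge h
  induction m with
  | zero =>
    intro r _ R hR
    have key : ∀ {Ω : Type} [MeasurableSpace Ω] (μ : Measure Ω) [IsProbabilityMeasure μ]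
        (f : Ω → ℝ), ∫⁻ ω, r (f ω) ∂μ ≤ R := fun μ _ f =>
      (lintegral_mono fun ω => hR (f ω)).trans (by simp)
    simp only [pow_zero, mul_one]
    exact ⟨(key _ _).trans le_add_self, (key _ fun b => b).trans le_add_self⟩
  | succ m ih =>
    intro r hr R hR
    -- The contribution of a delivery at the last step is the same for both laws. Only the
    -- interrupted part `r'` has to be compared, and its bound has shrunk by the factor P(H > G).
    set r' : ℝ → ℝ≥0∞ := fun b => ∫⁻ p in deliveredSetᶜ, r (b + p.1) ∂γ.prod η with hr'
    have hr'm : Measurable r' := Measurable.lintegral_prod_right' (f := fun z : ℝ × ℝ × ℝ =>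
      r (z.1 + z.2.1)) (by fun_prop)
    have hr'R : ∀ b, r' b ≤ R * (γ.prod η) deliveredSetᶜ := fun b =>
      (lintegral_mono fun p => hR _).trans (by simp)
    obtain ⟨h1, h2⟩ := ih hr'm hr'R
    have e1 : ∫⁻ p, r (ageChain p (m + 1)) ∂(Measure.infinitePi fun _ : ℕ => γ.prod η) =
        ∫⁻ p in deliveredSet, r p.1 ∂γ.prod η +
          ∫⁻ p, r' (ageChain p m) ∂(Measure.infinitePi fun _ : ℕ => γ.prod η) := by
      have hm := measurable_ageChain m
      have : IsProbabilityMeasure ((Measure.infinitePi fun _ : ℕ => γ.prod η).map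
          fun p => ageChain p m) := Measure.isProbabilityMeasure_map hm.aemeasurable
      simp only [ageChain_succ]
      rw [lintegral_ageChain (F := fun z => r (ageStep z.1 z.2)) (hr.comp measurable_ageStep) m,
        ← lintegral_map (f := fun b => ∫⁻ q, r (ageStep b q) ∂γ.prod η) _ hm,
        lintegral_ageStep r, lintegral_map hr'm hm]
      exact Measurable.lintegral_prod_right' (f := fun z : ℝ × ℝ × ℝ => r (ageStep z.1 z.2))
        (hr.comp measurable_ageStep)
    rw [e1, lintegral_stationaryArrivalAge γ η hr, pow_succ', ← mul_assoc, add_assoc, add_assoc]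
    exact ⟨add_le_add_right h1 _, add_le_add_right h2 _⟩

/-- A negative age can arise only by interruption from a negative age, so invariance gives β(-∞, 0)
≤ P(H > G) β(-∞, 0), with a factor strictly below one. -/
theorem stationaryArrivalAge_Iio_zero (h : (γ.prod η) deliveredSet ≠ 0) (hγ : ∀ᵐ x ∂γ, 0 ≤ x) :
    stationaryArrivalAge γ η (Set.Iio 0) = 0 := by
  have := isProbabilityMeasure_stationaryArrivalAge h
  have hp : ∀ᵐ p ∂γ.prod η, 0 ≤ p.1 := Measure.quasiMeasurePreserving_fst.ae hγ
  have hf : Measurable (Set.indicator (Set.Iio (0 : ℝ)) (1 : ℝ → ℝ≥0∞)) :=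
    measurable_one.indicator measurableSet_Iio
  have hfix := lintegral_stationaryArrivalAge γ η hf
  rw [lintegral_indicator_one measurableSet_Iio] at hfix
  have h1 : ∫⁻ p in deliveredSet, Set.indicator (Set.Iio (0 : ℝ)) (1 : ℝ → ℝ≥0∞) p.1 ∂γ.prod η
      = 0 := by
    rw [lintegral_congr_ae (g := 0), Pi.zero_def, lintegral_zero]
    filter_upwards [ae_restrict_of_ae hp] with p hp
    simp [hp]
  have h2 : ∀ b, ∫⁻ p in deliveredSetᶜ, Set.indicator (Set.Iio (0 : ℝ)) (1 : ℝ → ℝ≥0∞) (b + p.1)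
      ∂γ.prod η ≤ (γ.prod η) deliveredSetᶜ * Set.indicator (Set.Iio (0 : ℝ)) (1 : ℝ → ℝ≥0∞) b := by
    intro b
    calc _ ≤ ∫⁻ p in deliveredSetᶜ, Set.indicator (Set.Iio (0 : ℝ)) (1 : ℝ → ℝ≥0∞) b
          ∂γ.prod η := by
          refine lintegral_mono_ae ?_
          filter_upwards [ae_restrict_of_ae hp] with p hp
          by_cases hb : b + p.1 < 0
          · have : b < 0 := by linarith
            simp [this, hb]
          · simp [hb]
      _ = _ := by rw [lintegral_const, Measure.restrict_apply_univ, mul_comm]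
  have h3 : stationaryArrivalAge γ η (Set.Iio 0) ≤
      (γ.prod η) deliveredSetᶜ * stationaryArrivalAge γ η (Set.Iio 0) := by
    conv_lhs => rw [hfix, h1, zero_add]
    refine (lintegral_mono h2).trans_eq ?_
    rw [lintegral_const_mul _ hf, lintegral_indicator_one measurableSet_Iio]
  by_contra h0
  have hq : (γ.prod η) deliveredSetᶜ < 1 := by
    rw [prob_compl_eq_one_sub measurableSet_deliveredSet]
    exact ENNReal.sub_lt_self ENNReal.one_ne_top one_ne_zero h
  have := ENNReal.mul_lt_mul_left h0 (measure_ne_top _ _) hq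
  rw [one_mul] at this
  exact absurd h3 (not_le.2 this)

end Stationary

/-! ### The stationary law of the age and convergence of packet averages -/

/-- The stationary law of the age: the time average of the sawtooth over an interarrival interval,
with the stationary age at its beginning. -/
noncomputable def stationaryAge (γ η : Measure ℝ) : Measure ℝ :=
  (∫⁻ x, ENNReal.ofReal x ∂γ)⁻¹ •
    ((((stationaryArrivalAge γ η).prod (γ.prod η)).prod volume).restrict
      {z | 0 ≤ z.2 ∧ z.2 < z.1.2.1}).map fun z => sawtooth z.1.1 z.1.2.2 z.2

section StationaryAge

variable {γ η : Measure ℝ}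

theorem lintegral_prod_ofReal_fst [SFinite γ] [IsProbabilityMeasure η] :
    ∫⁻ p, ENNReal.ofReal p.1 ∂γ.prod η = ∫⁻ x, ENNReal.ofReal x ∂γ := by
  rw [lintegral_prod _ (by fun_prop)]
  simp

variable [IsProbabilityMeasure γ] [IsProbabilityMeasure η]

theorem lintegral_stationaryAge {f : ℝ → ℝ≥0∞} (hf : Measurable f) :
    ∫⁻ a, f a ∂stationaryAge γ η = (∫⁻ x, ENNReal.ofReal x ∂γ)⁻¹ *
      ∫⁻ b, ∫⁻ p, (∫⁻ u in Set.Ico 0 p.1, f (sawtooth b p.2 u))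
        ∂γ.prod η ∂stationaryArrivalAge γ η := by
  have hS : MeasurableSet {z : (ℝ × ℝ × ℝ) × ℝ | 0 ≤ z.2 ∧ z.2 < z.1.2.1} :=
    (measurableSet_le measurable_const measurable_snd).inter
      (measurableSet_lt measurable_snd (by fun_prop))
  have hF : Measurable fun z : (ℝ × ℝ × ℝ) × ℝ => f (sawtooth z.1.1 z.1.2.2 z.2) :=
    hf.comp measurable_sawtooth
  rw [stationaryAge, lintegral_smul_measure, lintegral_map hf measurable_sawtooth,
    ← lintegral_indicator hS, lintegral_prod _ (hF.indicator hS).aemeasurable,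
    lintegral_prod _ (hF.indicator hS).lintegral_prod_right'.aemeasurable, smul_eq_mul]
  congr 1
  refine lintegral_congr fun b => lintegral_congr fun p => ?_
  rw [← lintegral_indicator measurableSet_Ico]
  rfl

theorem lintegral_Ico_indicator_Iic_sawtooth (x b : ℝ) (p : ℝ × ℝ) :
    ∫⁻ u in Set.Ico 0 p.1, (Set.Iic x).indicator 1 (sawtooth b p.2 u) = timeBelow x b p := by
  have hm : Measurable fun u => sawtooth b p.2 u :=
    measurable_sawtooth.comp (measurable_const (a := (b, p)) |>.prodMk measurable_id)
  have : (fun u => (Set.Iic x).indicator (1 : ℝ → ℝ≥0∞) (sawtooth b p.2 u)) =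
      ((fun u => sawtooth b p.2 u) ⁻¹' Set.Iic x).indicator 1 := rfl
  rw [this, lintegral_indicator_one (hm measurableSet_Iic),
    Measure.restrict_apply (hm measurableSet_Iic), timeBelow]
  congr 1
  ext u
  simp [and_comm]

theorem stationaryAge_Iic (x : ℝ) : stationaryAge γ η (Set.Iic x) =
    (∫⁻ x, ENNReal.ofReal x ∂γ)⁻¹ *
      ∫⁻ b, ∫⁻ p, timeBelow x b p ∂γ.prod η ∂stationaryArrivalAge γ η := by
  rw [← lintegral_indicator_one measurableSet_Iic,
    lintegral_stationaryAge (measurable_one.indicator measurableSet_Iic)]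
  simp_rw [lintegral_Ico_indicator_Iic_sawtooth]

theorem isProbabilityMeasure_stationaryAge (h : (γ.prod η) deliveredSet ≠ 0)
    (h0 : ∫⁻ x, ENNReal.ofReal x ∂γ ≠ 0) (htop : ∫⁻ x, ENNReal.ofReal x ∂γ ≠ ∞) :
    IsProbabilityMeasure (stationaryAge γ η) := by
  have := isProbabilityMeasure_stationaryArrivalAge h
  constructor
  rw [← lintegral_one, lintegral_stationaryAge measurable_const]
  simp only [lintegral_const, one_mul, Measure.restrict_apply_univ, Real.volume_Ico, sub_zero,
    measure_univ, mul_one]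
  rw [lintegral_prod_ofReal_fst, ENNReal.inv_mul_cancel h0 htop]

theorem prob_compl_deliveredSet_lt_one (h : (γ.prod η) deliveredSet ≠ 0) :
    (γ.prod η) deliveredSetᶜ < 1 := by
  rw [prob_compl_eq_one_sub measurableSet_deliveredSet]
  exact ENNReal.sub_lt_self ENNReal.one_ne_top one_ne_zero h

/-- Packet m is independent of the m packets before it. This is the mean error of restarting the
chain m packets earlier: the error occurs only if all of them are interrupted, and it is at most one
interarrival time. -/
theorem lintegral_indicator_interrupted (m : ℕ) :
    ∫⁻ p, {p : ℕ → ℝ × ℝ | ∀ i < m, p i ∉ deliveredSet}.indicator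
        (fun p => ENNReal.ofReal (p m).1) p ∂(Measure.infinitePi fun _ : ℕ => γ.prod η) =
      (∫⁻ x, ENNReal.ofReal x ∂γ) * (γ.prod η) deliveredSetᶜ ^ m := by
  set S := {p : ℕ → ℝ × ℝ | ∀ i < m, p i ∉ deliveredSet} with hS
  have hS' : S = Set.pi (Finset.range m) fun _ => deliveredSetᶜ := by
    ext p; simp [hS]
  have hSm : MeasurableSet S := by
    rw [hS']
    exact MeasurableSet.pi (Finset.countable_toSet _) fun _ _ => measurableSet_deliveredSet.compl
  have h1 : Measurable (S.indicator (1 : (ℕ → ℝ × ℝ) → ℝ≥0∞)) := measurable_one.indicator hSm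
  have h2 : Measurable fun p : ℕ → ℝ × ℝ => ENNReal.ofReal (p m).1 := by fun_prop
  have hind : IndepFun (S.indicator (1 : (ℕ → ℝ × ℝ) → ℝ≥0∞)) (fun p => ENNReal.ofReal (p m).1)
      (Measure.infinitePi fun _ : ℕ => γ.prod η) := by
    refine indepFun_infinitePi_of_dependsOn (S := Finset.range m) (T := {m}) _ h1 h2 ?_ ?_ (by simp)
    · intro p q hpq
      have : p ∈ S ↔ q ∈ S := by
        simp only [hS, Set.mem_ofPred_eq]
        exact forall₂_congr fun i hi => by rw [hpq i (by simpa using hi)]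
      by_cases hp : p ∈ S
      · rw [Set.indicator_of_mem hp, Set.indicator_of_mem (this.1 hp)]
        rfl
      · rw [Set.indicator_of_notMem hp, Set.indicator_of_notMem (mt this.2 hp)]
    · intro p q hpq
      simp [hpq m (by simp)]
  have hmul := lintegral_mul_eq_lintegral_mul_lintegral_of_indepFun h1 h2 hind
  have e : (S.indicator (1 : (ℕ → ℝ × ℝ) → ℝ≥0∞) * fun p => ENNReal.ofReal (p m).1) =
      S.indicator fun p => ENNReal.ofReal (p m).1 := by
    ext p
    by_cases hp : p ∈ S <;> simp [hp]
  rw [e] at hmul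
  have hm : ∫⁻ p, ENNReal.ofReal (p m).1 ∂(Measure.infinitePi fun _ : ℕ => γ.prod η) =
      ∫⁻ x, ENNReal.ofReal x ∂γ := by
    have := lintegral_map (μ := Measure.infinitePi fun _ : ℕ => γ.prod η)
      (f := fun p : ℝ × ℝ => ENNReal.ofReal p.1) (by fun_prop) (measurable_pi_apply m)
    rw [← this, Measure.infinitePi_map_eval, lintegral_prod_ofReal_fst]
  rw [hmul, lintegral_indicator_one hSm, hS', hm, Measure.infinitePi_pi _
    fun _ _ => measurableSet_deliveredSet.compl, mul_comm]
  simp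

theorem ae_infinitePi_fst_nonneg (hγ : ∀ᵐ x ∂γ, 0 ≤ x) :
    ∀ᵐ p ∂(Measure.infinitePi fun _ : ℕ => γ.prod η), ∀ n, 0 ≤ (p n).1 := by
  refine ae_all_iff.2 fun n => ?_
  have : ∀ᵐ p ∂γ.prod η, 0 ≤ p.1 := Measure.quasiMeasurePreserving_fst.ae hγ
  rw [← Measure.infinitePi_map_eval (fun _ : ℕ => γ.prod η) n] at this
  exact ae_of_ae_map (measurable_pi_apply n).aemeasurable this

/-- Almost surely, the average over packets of the time that the age spends in `(-∞, x]` until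
the next arrival converges to its stationary mean. -/
theorem ae_tendsto_average_timeBelow (h : (γ.prod η) deliveredSet ≠ 0) (hγ : ∀ᵐ x ∂γ, 0 ≤ x)
    (htop : ∫⁻ x, ENNReal.ofReal x ∂γ ≠ ∞) (x : ℝ) :
    ∀ᵐ p ∂(Measure.infinitePi fun _ : ℕ => γ.prod η), Tendsto (fun N : ℕ =>
      (∑ n ∈ Finset.range N, (timeBelow x (ageChain p n) (p n)).toReal) / N) atTop
      (𝓝 (∫⁻ b, ∫⁻ p, timeBelow x b p ∂γ.prod η ∂stationaryArrivalAge γ η).toReal) := by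
  have := isProbabilityMeasure_stationaryArrivalAge h
  set Pr := Measure.infinitePi fun _ : ℕ => γ.prod η with hPr
  set R := ∫⁻ x, ENNReal.ofReal x ∂γ with hR
  set r : ℝ → ℝ≥0∞ := fun b => ∫⁻ p, timeBelow x b p ∂γ.prod η with hr
  have hrm : Measurable r := (measurable_timeBelow x).lintegral_prod_right'
  have hrR : ∀ b, r b ≤ R := fun b =>
    (lintegral_mono fun p => timeBelow_le x b p).trans_eq lintegral_prod_ofReal_fst
  -- `U m` is the time below x after packet m for the chain started from 0 at packet 0, and `V m`
  -- bounds its excess over the true value. Both depend on packets 0, …, m only, so the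
  -- finite-window strong law applies to their shifts.
  set U : ℕ → (ℕ → ℝ × ℝ) → ℝ≥0∞ := fun m p => timeBelow x (ageChain p m) (p m) with hU
  set V : ℕ → (ℕ → ℝ × ℝ) → ℝ≥0∞ := fun m => {p | ∀ i < m, p i ∉ deliveredSet}.indicator
    (fun p => ENNReal.ofReal (p m).1) with hV
  have hUm : ∀ m, Measurable (U m) := fun m =>
    (measurable_timeBelow x).comp ((measurable_ageChain m).prodMk (measurable_pi_apply m))
  have hVm : ∀ m, Measurable (V m) := fun m => by
    refine Measurable.indicator (by fun_prop) ?_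
    simp only [Set.ofPred_forall]
    exact .iInter fun i => .iInter fun _ =>
      measurableSet_deliveredSet.compl.preimage (measurable_pi_apply i)
  have hUi : ∀ m, ∫⁻ p, U m p ∂Pr = ∫⁻ p, r (ageChain p m) ∂Pr := fun m =>
    lintegral_ageChain (measurable_timeBelow x) m
  have hVi : ∀ m, ∫⁻ p, V m p ∂Pr = R * (γ.prod η) deliveredSetᶜ ^ m :=
    lintegral_indicator_interrupted
  have hUtop : ∀ m, ∫⁻ p, U m p ∂Pr ≠ ∞ := fun m => by
    rw [hUi]
    refine ne_top_of_le_ne_top htop ((lintegral_mono fun p => hrR _).trans ?_)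
    simp
  have hVtop : ∀ m, ∫⁻ p, V m p ∂Pr ≠ ∞ := fun m => by
    rw [hVi]
    exact ENNReal.mul_ne_top htop (ENNReal.pow_ne_top (measure_ne_top _ _))
  have hU1 : ∀ m p, U m p < ∞ := fun m p => (timeBelow_ne_top _ _ _).lt_top
  have hV1 : ∀ m p, V m p < ∞ := fun m p =>
    (Set.indicator_le_self' (fun _ _ => zero_le) p).trans_lt ENNReal.ofReal_lt_top
  have hUdep : ∀ m, DependsOn (fun p => (U m p).toReal) (Finset.range (m + 1)) := by
    intro m p q hpq
    simp only [hU]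
    rw [ageChain_congr fun i hi => hpq i (by simp; omega), hpq m (by simp)]
  have hVdep : ∀ m, DependsOn (fun p => (V m p).toReal) (Finset.range (m + 1)) := by
    intro m p q hpq
    have : p ∈ {p : ℕ → ℝ × ℝ | ∀ i < m, p i ∉ deliveredSet} ↔
        q ∈ {p : ℕ → ℝ × ℝ | ∀ i < m, p i ∉ deliveredSet} :=
      forall₂_congr fun i hi => by rw [hpq i (by simp; omega)]
    simp only [hV]
    congr 1
    by_cases hp : p ∈ {p : ℕ → ℝ × ℝ | ∀ i < m, p i ∉ deliveredSet}
    · rw [Set.indicator_of_mem hp, Set.indicator_of_mem (this.1 hp), hpq m (by simp)]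
    · rw [Set.indicator_of_notMem hp, Set.indicator_of_notMem (mt this.2 hp)]
  have slU : ∀ m, ∀ᵐ p ∂Pr, Tendsto (fun N : ℕ => (∑ n ∈ Finset.range N,
      (U m fun i => p (n + i)).toReal) / N) atTop (𝓝 (∫⁻ p, U m p ∂Pr).toReal) := by
    intro m
    rw [← integral_toReal (hUm m).aemeasurable (.of_forall (hU1 m))]
    exact strong_law_finite_window _ (hUm m).ennreal_toReal (fun _ => ENNReal.toReal_nonneg)
      (hUdep m) (integrable_toReal_of_lintegral_ne_top (hUm m).aemeasurable (hUtop m))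
  have slV : ∀ m, ∀ᵐ p ∂Pr, Tendsto (fun N : ℕ => (∑ n ∈ Finset.range N,
      (V m fun i => p (n + i)).toReal) / N) atTop (𝓝 (∫⁻ p, V m p ∂Pr).toReal) := by
    intro m
    rw [← integral_toReal (hVm m).aemeasurable (.of_forall (hV1 m))]
    exact strong_law_finite_window _ (hVm m).ennreal_toReal (fun _ => ENNReal.toReal_nonneg)
      (hVdep m) (integrable_toReal_of_lintegral_ne_top (hVm m).aemeasurable (hVtop m))
  have hVlim : Tendsto (fun m => ∫⁻ p, V m p ∂Pr) atTop (𝓝 0) := by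
    simp_rw [hVi]
    simpa using ENNReal.Tendsto.const_mul (a := R)
      (ENNReal.tendsto_pow_atTop_nhds_zero_of_lt_one (prob_compl_deliveredSet_lt_one h))
      (.inr htop)
  have hCtop : ∫⁻ b, r b ∂stationaryArrivalAge γ η ≠ ∞ :=
    ne_top_of_le_ne_top htop ((lintegral_mono hrR).trans (by simp))
  have hUlim : Tendsto (fun m => ∫⁻ p, U m p ∂Pr) atTop
      (𝓝 (∫⁻ b, r b ∂stationaryArrivalAge γ η)) := by
    have near := fun m => lintegral_ageChain_near h m hrm hrR
    refine tendsto_of_tendsto_of_tendsto_of_le_of_le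
      (g := fun m => ∫⁻ b, r b ∂stationaryArrivalAge γ η - ∫⁻ p, V m p ∂Pr)
      (h := fun m => ∫⁻ b, r b ∂stationaryArrivalAge γ η + ∫⁻ p, V m p ∂Pr) ?_ ?_ ?_ ?_
    · simpa using ENNReal.Tendsto.sub tendsto_const_nhds hVlim (.inl hCtop)
    · simpa using tendsto_const_nhds.add hVlim
    · intro m
      simp only [hVi, hUi]
      exact tsub_le_iff_right.2 (near m).2
    · intro m
      simp only [hVi, hUi]
      exact (near m).1
  have hVlim' : Tendsto (fun m => (∫⁻ p, V m p ∂Pr).toReal) atTop (𝓝 0) := by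
    simpa [Function.comp_def] using (ENNReal.tendsto_toReal ENNReal.zero_ne_top).comp hVlim
  have hUlim' := (ENNReal.tendsto_toReal hCtop).comp hUlim
  filter_upwards [ae_infinitePi_fst_nonneg hγ, ae_all_iff.2 slU, ae_all_iff.2 slV]
    with p hp hpU hpV
  refine tendsto_average_of_sandwich
    (l := fun m n => (U m fun i => p (n + i)).toReal - (V m fun i => p (n + i)).toReal)
    (u := fun m n => (U m fun i => p (n + i)).toReal)
    (cl := fun m => (∫⁻ p, U m p ∂Pr).toReal - (∫⁻ p, V m p ∂Pr).toReal)
    (cu := fun m => (∫⁻ p, U m p ∂Pr).toReal) ?_ ?_ ?_ hpU ?_ hUlim'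
  -- With a delivery in the window the restarted chain is exact; without one, U ≤ V and the lower
  -- bound is non-positive.
  · intro m n
    by_cases hs : ∃ i < m, p (n + i) ∈ deliveredSet
    · simp only [hU]
      rw [ageChain_shift_eq hs]
      exact sub_le_self _ ENNReal.toReal_nonneg
    · have e : (fun i => p (n + i)) ∈ {p : ℕ → ℝ × ℝ | ∀ i < m, p i ∉ deliveredSet} := by
        push Not at hs
        exact hs
      have : (U m fun i => p (n + i)).toReal ≤ (V m fun i => p (n + i)).toReal := by
        refine ENNReal.toReal_mono (hV1 _ _).ne ?_
        simp only [hV, Set.indicator_of_mem e]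
        exact timeBelow_le _ _ _
      exact (sub_nonpos.2 this).trans ENNReal.toReal_nonneg
  · intro m n
    exact ENNReal.toReal_mono (hU1 _ _).ne (timeBelow_anti (ageChain_shift_le hp n m) _)
  · intro m
    simp_rw [Finset.sum_sub_distrib, sub_div]
    exact (hpU m).sub (hpV m)
  · simpa using hUlim'.sub hVlim'

end StationaryAge

/-! ### Almost sure deliveries, mean interarrival time, continuity in the level -/

section AlmostSure

variable {γ η : Measure ℝ} [IsProbabilityMeasure γ] [IsProbabilityMeasure η]

theorem ae_exists_mem_deliveredSet (h : (γ.prod η) deliveredSet ≠ 0) :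
    ∀ᵐ p ∂(Measure.infinitePi fun _ : ℕ => γ.prod η), ∃ n, p n ∈ deliveredSet := by
  have hle : ∀ m : ℕ, (Measure.infinitePi fun _ : ℕ => γ.prod η) {p | ¬ ∃ n, p n ∈ deliveredSet} ≤
      (γ.prod η) deliveredSetᶜ ^ m := by
    intro m
    have := Measure.infinitePi_pi (fun _ : ℕ => γ.prod η) (s := Finset.range m)
      (t := fun _ => deliveredSetᶜ) fun _ _ => measurableSet_deliveredSet.compl
    rw [Finset.prod_const, Finset.card_range] at this
    rw [← this]
    refine measure_mono fun p hp n _ hn => hp ⟨n, hn⟩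
  exact le_antisymm (ge_of_tendsto' (ENNReal.tendsto_pow_atTop_nhds_zero_of_lt_one
    (prob_compl_deliveredSet_lt_one h)) hle) zero_le

theorem ae_tendsto_average_fst (hγ : ∀ᵐ x ∂γ, 0 ≤ x) (htop : ∫⁻ x, ENNReal.ofReal x ∂γ ≠ ∞) :
    ∀ᵐ p ∂(Measure.infinitePi fun _ : ℕ => γ.prod η), Tendsto (fun N : ℕ =>
      (∑ n ∈ Finset.range N, (p n).1) / (N : ℝ)) atTop (𝓝 (∫⁻ x, ENNReal.ofReal x ∂γ).toReal) := by
  have hm : Measurable fun p : ℕ → ℝ × ℝ => ENNReal.ofReal (p 0).1 := by fun_prop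
  have hi : ∫⁻ p, ENNReal.ofReal (p 0).1 ∂(Measure.infinitePi fun _ : ℕ => γ.prod η) =
      ∫⁻ x, ENNReal.ofReal x ∂γ := by
    have := lintegral_map (μ := Measure.infinitePi fun _ : ℕ => γ.prod η)
      (f := fun p : ℝ × ℝ => ENNReal.ofReal p.1) (by fun_prop) (measurable_pi_apply 0)
    rw [← this, Measure.infinitePi_map_eval, lintegral_prod_ofReal_fst]
  have sl := strong_law_finite_window (γ.prod η) hm.ennreal_toReal
    (fun _ => ENNReal.toReal_nonneg) (M := 1) (fun p q hpq => by simp [hpq 0 (by simp)])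
    (integrable_toReal_of_lintegral_ne_top hm.aemeasurable (hi ▸ htop))
  rw [integral_toReal hm.aemeasurable (.of_forall fun _ => ENNReal.ofReal_lt_top), hi] at sl
  filter_upwards [sl, ae_infinitePi_fst_nonneg hγ] with p hp hp0
  simpa [ENNReal.toReal_ofReal (hp0 _)] using hp

/-- Both branches of the sawtooth have slope one in u, so for x ≤ y each spends at most y - x in (x,
y]; the two branches give the factor 2. -/
theorem timeBelow_le_add (x y b : ℝ) (p : ℝ × ℝ) :
    timeBelow y b p ≤ timeBelow x b p + ENNReal.ofReal (2 * (y - x)) := by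
  have hsub : {u | (0 ≤ u ∧ u < p.1) ∧ sawtooth b p.2 u ≤ y} ⊆
      {u | (0 ≤ u ∧ u < p.1) ∧ sawtooth b p.2 u ≤ x} ∪
        (Set.Ioc x y ∪ Set.Ioc (x - b) (y - b)) := by
    rintro u ⟨hu, huy⟩
    by_cases hux : sawtooth b p.2 u ≤ x
    · exact .inl ⟨hu, hux⟩
    · unfold sawtooth at hux huy
      right
      split_ifs at hux huy
      · exact .inl ⟨not_le.1 hux, huy⟩
      · exact .inr ⟨by linarith, by linarith⟩
  refine (measure_mono hsub).trans ((measure_union_le _ _).trans ?_)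
  gcongr
  · exact le_rfl
  · refine (measure_union_le _ _).trans_eq ?_
    rw [Real.volume_Ioc, Real.volume_Ioc, sub_sub_sub_cancel_right, ← two_mul,
      ENNReal.ofReal_mul zero_le_two, ENNReal.ofReal_ofNat]

/-- The preceding estimate makes the distribution function Lipschitz. Continuity is what later
extends convergence from rational levels to all levels outside a single null set. -/
theorem continuous_stationaryAge_Iic (h : (γ.prod η) deliveredSet ≠ 0)
    (htop : ∫⁻ x, ENNReal.ofReal x ∂γ ≠ ∞) :
    Continuous fun x => (stationaryAge γ η).real (Set.Iic x) := by
  have := isProbabilityMeasure_stationaryArrivalAge h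
  set C : ℝ → ℝ≥0∞ := fun x => ∫⁻ b, ∫⁻ p, timeBelow x b p ∂γ.prod η ∂stationaryArrivalAge γ η
  have hC : ∀ x, C x ≠ ∞ := fun x => ne_top_of_le_ne_top htop <|
    (lintegral_mono fun b => (lintegral_mono fun p => timeBelow_le x b p).trans_eq
      lintegral_prod_ofReal_fst).trans (by simp)
  have hlip : LipschitzWith 2 fun x => (C x).toReal := by
    refine LipschitzWith.of_le_add_mul _ fun y x => ?_
    have h1 : C y ≤ C x + ENNReal.ofReal (2 * dist y x) := by
      calc C y ≤ ∫⁻ b, ∫⁻ p, (timeBelow x b p + ENNReal.ofReal (2 * dist y x))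
            ∂γ.prod η ∂stationaryArrivalAge γ η := by
            refine lintegral_mono fun b => lintegral_mono fun p =>
              (timeBelow_le_add x y b p).trans ?_
            gcongr
            exact le_abs_self _
        _ = _ := by
            simp_rw [lintegral_add_right _ measurable_const, lintegral_const, measure_univ, mul_one]
            rfl
    have h2 := ENNReal.toReal_mono (ENNReal.add_ne_top.2 ⟨hC x, ENNReal.ofReal_ne_top⟩) h1
    rwa [ENNReal.toReal_add (hC x) ENNReal.ofReal_ne_top,
      ENNReal.toReal_ofReal (by positivity)] at h2
  simp_rw [measureReal_def, stationaryAge_Iic, ENNReal.toReal_mul]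
  exact hlip.continuous.const_mul _

end AlmostSure

/-! ### From packet averages to time averages of the age process -/

namespace PreemptiveLCFS

variable {Ω : Type*} [MeasurableSpace Ω] {P : Measure Ω} {γ η : Measure ℝ}
  (Q : PreemptiveLCFS P γ η) {ω : Ω}

/-- The almost sure sign conditions on the primitive data. -/
structure Regular (Q : PreemptiveLCFS P γ η) (ω : Ω) : Prop where
  G_nonneg : ∀ n, 0 ≤ Q.G n ω
  H_nonneg : ∀ n, 0 ≤ Q.H n ω
  firstArrival_nonneg : 0 ≤ Q.firstArrival ω
  initStamp_nonpos : Q.initStamp ω ≤ 0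
  oldStamp_nonpos : Q.oldStamp ω ≤ 0

theorem ae_regular : ∀ᵐ ω ∂P, Q.Regular ω := by
  have hG : ∀ᵐ ω ∂P, ∀ n, 0 ≤ Q.G n ω := ae_all_iff.2 fun n =>
    ae_of_ae_map (Q.hasLaw_G n).aemeasurable ((Q.hasLaw_G n).map_eq.symm ▸ Q.nonneg_G)
  have hH : ∀ᵐ ω ∂P, ∀ n, 0 ≤ Q.H n ω := ae_all_iff.2 fun n =>
    ae_of_ae_map (Q.hasLaw_H n).aemeasurable ((Q.hasLaw_H n).map_eq.symm ▸ Q.nonneg_H)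
  filter_upwards [hG, hH, Q.firstArrival_nonneg, Q.initStamp_nonpos, Q.oldStamp_nonpos]
    with ω h1 h2 h3 h4 h5 using ⟨h1, h2, h3, h4, h5⟩

/-- The sequence of interarrival and service times. -/
def packet (ω : Ω) (n : ℕ) : ℝ × ℝ := (Q.G n ω, Q.H n ω)

theorem arrival_succ (n : ℕ) (ω : Ω) : Q.arrival (n + 1) ω = Q.arrival n ω + Q.G n ω := by
  rw [arrival, arrival, Finset.sum_range_succ, add_assoc]

variable {Q}

theorem Regular.arrival_mono (h : Q.Regular ω) : Monotone fun n => Q.arrival n ω :=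
  monotone_nat_of_le_succ fun n => by
    rw [arrival_succ]; exact le_add_of_nonneg_right (h.G_nonneg n)

theorem Regular.arrival_nonneg (h : Q.Regular ω) (n : ℕ) : 0 ≤ Q.arrival n ω := by
  refine le_trans ?_ (h.arrival_mono (Nat.zero_le n))
  simpa [arrival] using h.firstArrival_nonneg

/-- Once a packet has been delivered, `ageChain` is the age just before the arrivals. -/
theorem Regular.isGreatest_delivered (h : Q.Regular ω) {n : ℕ}
    (hn : ∃ k < n, Q.H k ω ≤ Q.G k ω) :
    IsGreatest {u | ∃ k < n, Q.H k ω ≤ Q.G k ω ∧ u = Q.arrival k ω}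
      (Q.arrival n ω - ageChain (Q.packet ω) n) := by
  induction n with
  | zero => simp at hn
  | succ n ih =>
    by_cases hs : Q.H n ω ≤ Q.G n ω
    · have e : Q.arrival (n + 1) ω - ageChain (Q.packet ω) (n + 1) = Q.arrival n ω := by
        simp [ageChain_succ, ageStep, arrival_succ, packet, hs]
      rw [e]
      refine ⟨⟨n, n.lt_succ_self, hs, rfl⟩, ?_⟩
      rintro _ ⟨k, hk, -, rfl⟩
      exact h.arrival_mono (Nat.lt_succ_iff.1 hk)
    · have e : Q.arrival (n + 1) ω - ageChain (Q.packet ω) (n + 1) =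
          Q.arrival n ω - ageChain (Q.packet ω) n := by
        simp only [ageChain_succ, ageStep, arrival_succ, packet, hs, if_false]
        ring
      rw [e]
      have hlt : ∀ k, k < n + 1 → Q.H k ω ≤ Q.G k ω → k < n := fun k hk hk' =>
        lt_of_le_of_ne (Nat.lt_succ_iff.1 hk) (by rintro rfl; exact hs hk')
      obtain ⟨k, hk, hk'⟩ := hn
      obtain ⟨⟨j, hj, hj', hje⟩, hub⟩ := ih ⟨k, hlt k hk hk', hk'⟩
      refine ⟨⟨j, hj.trans n.lt_succ_self, hj', hje⟩, ?_⟩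
      rintro _ ⟨i, hi, hi', rfl⟩
      exact hub ⟨i, hlt i hi hi', hi', rfl⟩

/-- Between two arrivals, once a packet has been delivered, the age is a sawtooth. -/
theorem Regular.aoi_eq_sawtooth (h : Q.Regular ω) {n : ℕ} (hn : ∃ k < n, Q.H k ω ≤ Q.G k ω) {t : ℝ}
    (ht : Q.arrival n ω ≤ t) (ht' : t < Q.arrival (n + 1) ω) :
    Q.aoi ω t = sawtooth (ageChain (Q.packet ω) n) (Q.H n ω) (t - Q.arrival n ω) := by
  have hle : ∀ k, Q.DeliveredBy ω k t → k ≤ n := by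
    intro k hk
    by_contra! hkn
    have h1 := h.arrival_mono (Nat.succ_le_of_lt hkn)
    have h2 := h.H_nonneg k
    have h3 := hk.2
    simp only [Nat.succ_eq_add_one] at h1
    linarith
  suffices IsGreatest (Q.receivedStamps ω t)
      (t - sawtooth (ageChain (Q.packet ω) n) (Q.H n ω) (t - Q.arrival n ω)) by
    rw [aoi, displayedStamp, this.csSup_eq, sub_sub_cancel]
  have hn0 := h.arrival_nonneg n
  unfold sawtooth
  split_ifs with hs
  · rw [sub_sub_cancel]
    rw [arrival_succ] at ht'
    refine ⟨.inr (.inr ⟨n, ⟨by linarith, by linarith⟩, rfl⟩), ?_⟩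
    rintro _ (rfl | ⟨-, rfl⟩ | ⟨k, hk, rfl⟩)
    · exact h.initStamp_nonpos.trans hn0
    · exact h.oldStamp_nonpos.trans hn0
    · exact h.arrival_mono (hle k hk)
  · obtain ⟨⟨j, hj, hj', hje⟩, hub⟩ := h.isGreatest_delivered hn
    have e : t - (ageChain (Q.packet ω) n + (t - Q.arrival n ω)) =
        Q.arrival n ω - ageChain (Q.packet ω) n := by ring
    rw [e]
    refine ⟨.inr (.inr ⟨j, ⟨hj', ?_⟩, hje⟩), ?_⟩
    · have := h.arrival_mono (Nat.succ_le_of_lt hj)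
      simp only [Nat.succ_eq_add_one, arrival_succ] at this
      linarith
    · rintro _ (rfl | ⟨-, rfl⟩ | ⟨k, hk, rfl⟩)
      · rw [hje]; exact h.initStamp_nonpos.trans (h.arrival_nonneg j)
      · rw [hje]; exact h.oldStamp_nonpos.trans (h.arrival_nonneg j)
      · refine hub ⟨k, lt_of_le_of_ne (hle k hk) ?_, hk.1, rfl⟩
        rintro rfl
        have := hk.2
        linarith

/-- Received stamps only accumulate, so the displayed stamp is monotone in time. The bound `max t 0`
keeps the supremum meaningful: initial stamps are at most 0, and delivered packets arrived by time
t. -/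
theorem Regular.measurable_aoi (h : Q.Regular ω) : Measurable (Q.aoi ω) := by
  refine measurable_id.sub (Monotone.measurable fun s t hst => ?_)
  refine csSup_le_csSup ⟨max t 0, ?_⟩ ⟨_, .inl rfl⟩ ?_
  · rintro _ (rfl | ⟨-, rfl⟩ | ⟨k, hk, rfl⟩)
    · exact h.initStamp_nonpos.trans (le_max_right _ _)
    · exact h.oldStamp_nonpos.trans (le_max_right _ _)
    · refine le_max_of_le_left ((le_add_of_nonneg_right (h.H_nonneg k)).trans hk.2)
  · rintro u (hu | ⟨hu, hu'⟩ | ⟨k, hk, hu⟩)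
    · exact .inl hu
    · exact .inr (.inl ⟨⟨hu.1, hu.2.trans hst⟩, hu'⟩)
    · exact .inr (.inr ⟨k, ⟨hk.1, hk.2.trans hst⟩, hu⟩)

theorem Regular.intervalIntegrable_indicator (h : Q.Regular ω) (x a b : ℝ) :
    IntervalIntegrable ({s | Q.aoi ω s ≤ x}.indicator fun _ => (1 : ℝ)) volume a b := by
  have hm : MeasurableSet {s | Q.aoi ω s ≤ x} := measurableSet_le h.measurable_aoi measurable_const
  exact ⟨(integrable_const _).indicator hm, (integrable_const _).indicator hm⟩

theorem Regular.integral_interarrival (h : Q.Regular ω) {n : ℕ}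
    (hn : ∃ k < n, Q.H k ω ≤ Q.G k ω) (x : ℝ) :
    ∫ t in Q.arrival n ω..Q.arrival (n + 1) ω, {s | Q.aoi ω s ≤ x}.indicator (fun _ => (1 : ℝ)) t =
      (timeBelow x (ageChain (Q.packet ω) n) (Q.packet ω n)).toReal := by
  have hm : MeasurableSet {s | Q.aoi ω s ≤ x} := measurableSet_le h.measurable_aoi measurable_const
  have hshift : volume {u | (0 ≤ u ∧ u < (Q.packet ω n).1) ∧
      sawtooth (ageChain (Q.packet ω) n) (Q.packet ω n).2 u ≤ x} =
      volume ((fun t => t - Q.arrival n ω) ⁻¹' {u | (0 ≤ u ∧ u < (Q.packet ω n).1) ∧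
        sawtooth (ageChain (Q.packet ω) n) (Q.packet ω n).2 u ≤ x}) :=
    ((measurePreserving_sub_right volume (Q.arrival n ω)).measure_preimage_equiv
      (f := .subRight _) _).symm
  rw [intervalIntegral.integral_of_le (h.arrival_mono n.le_succ), ← integral_Ico_eq_integral_Ioc,
    integral_indicator_const _ hm, smul_eq_mul, mul_one, measureReal_def,
    Measure.restrict_apply hm, timeBelow, hshift]
  congr 2
  ext t
  simp only [Set.mem_inter_iff, Set.mem_ofPred_eq, Set.mem_Ico, Set.mem_preimage, sub_nonneg,
    sub_lt_iff_lt_add', packet, ← arrival_succ]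
  constructor
  · rintro ⟨h1, h2⟩
    exact ⟨h2, by rwa [← h.aoi_eq_sawtooth hn h2.1 h2.2]⟩
  · rintro ⟨h2, h1⟩
    exact ⟨by rwa [h.aoi_eq_sawtooth hn h2.1 h2.2], h2⟩

theorem Regular.integral_mono (h : Q.Regular ω) (x : ℝ) :
    Monotone fun T : ℝ => ∫ t in (0 : ℝ)..T, {s | Q.aoi ω s ≤ x}.indicator (fun _ => (1 : ℝ)) t := by
  intro S T hST
  have hi := h.intervalIntegrable_indicator x
  simp only
  rw [← intervalIntegral.integral_add_adjacent_intervals (hi 0 S) (hi S T)]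
  exact le_add_of_nonneg_right <| intervalIntegral.integral_nonneg hST fun t _ =>
    Set.indicator_nonneg (fun _ _ => zero_le_one) t

/-- Averages over packets determine averages over time. -/
theorem Regular.tendsto_time_average (h : Q.Regular ω) {k : ℕ} (hk : Q.H k ω ≤ Q.G k ω) {x a b : ℝ}
    (ha : 0 < a)
    (hG : Tendsto (fun N : ℕ => (∑ n ∈ Finset.range N, Q.G n ω) / N) atTop (𝓝 a))
    (hb : Tendsto (fun N : ℕ => (∑ n ∈ Finset.range N,
      (timeBelow x (ageChain (Q.packet ω) n) (Q.packet ω n)).toReal) / N) atTop (𝓝 b)) :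
    Tendsto (fun T : ℝ =>
      T⁻¹ * ∫ t in (0 : ℝ)..T, {s | Q.aoi ω s ≤ x}.indicator (fun _ => (1 : ℝ)) t)
      atTop (𝓝 (b / a)) := by
  refine tendsto_inv_mul_of_monotone (h.integral_mono x) ha (c := fun n => Q.arrival n ω) ?_ ?_
  · have := (tendsto_const_div_atTop_nhds_zero_nat (Q.firstArrival ω)).add hG
    simpa [arrival, add_div] using this
  · set f : ℝ → ℝ := fun t => {s | Q.aoi ω s ≤ x}.indicator (fun _ => (1 : ℝ)) t with hf
    set τ : ℕ → ℝ := fun n => (timeBelow x (ageChain (Q.packet ω) n) (Q.packet ω n)).toReal with hτ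
    have hi := h.intervalIntegrable_indicator x
    -- From arrival k + 1 on, packet k has been delivered and the chain is the true age. Time
    -- integrals and packet sums then differ by a constant, which disappears after division by N.
    have hsum : ∀ N, ∫ t in (0 : ℝ)..Q.arrival (k + 1 + N) ω, f t =
        (∫ t in (0 : ℝ)..Q.arrival (k + 1) ω, f t) - ∑ n ∈ Finset.range (k + 1), τ n +
          ∑ n ∈ Finset.range (k + 1 + N), τ n := by
      intro N
      induction N with
      | zero => simp
      | succ N ih =>
        rw [← add_assoc, ← intervalIntegral.integral_add_adjacent_intervals (hi 0 _) (hi _ _), ih,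
          h.integral_interarrival ⟨k, by omega, hk⟩, Finset.sum_range_succ _ (k + 1 + N)]
        ring
    set D := (∫ t in (0 : ℝ)..Q.arrival (k + 1) ω, f t) - ∑ n ∈ Finset.range (k + 1), τ n
    have := (tendsto_const_div_atTop_nhds_zero_nat D).add hb
    rw [zero_add] at this
    refine this.congr' ?_
    filter_upwards [eventually_ge_atTop (k + 1)] with N hN
    obtain ⟨M, rfl⟩ := Nat.exists_eq_add_of_le hN
    rw [hsum, add_div]

theorem lintegral_G_ne_top (Q : PreemptiveLCFS P γ η) : ∫⁻ x, ENNReal.ofReal x ∂γ ≠ ∞ :=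
  Q.integrable_G.lintegral_lt_top.ne

theorem lintegral_G_eq (Q : PreemptiveLCFS P γ η) :
    ∫⁻ x, ENNReal.ofReal x ∂γ = ENNReal.ofReal (∫ x, x ∂γ) :=
  (ofReal_integral_eq_lintegral_ofReal Q.integrable_G Q.nonneg_G).symm

variable [IsProbabilityMeasure P]

theorem isProbabilityMeasure_interarrival (Q : PreemptiveLCFS P γ η) :
    IsProbabilityMeasure γ :=
  (Q.hasLaw_G 0).map_eq ▸ Measure.isProbabilityMeasure_map (Q.hasLaw_G 0).aemeasurable

theorem isProbabilityMeasure_service (Q : PreemptiveLCFS P γ η) :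
    IsProbabilityMeasure η :=
  (Q.hasLaw_H 0).map_eq ▸ Measure.isProbabilityMeasure_map (Q.hasLaw_H 0).aemeasurable

/-- If packets have a chance to be delivered, the age has the stationary law `stationaryAge`. -/
theorem isStationaryAoI_stationaryAge (Q : PreemptiveLCFS P γ η) (h : (γ.prod η) deliveredSet ≠ 0) :
    Q.IsStationaryAoI (stationaryAge γ η) := by
  have := Q.isProbabilityMeasure_interarrival
  have := Q.isProbabilityMeasure_service
  have htop := Q.lintegral_G_ne_top
  have h0 : ∫⁻ x, ENNReal.ofReal x ∂γ ≠ 0 := by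
    rw [Q.lintegral_G_eq]
    exact (ENNReal.ofReal_pos.2 Q.mean_G_pos).ne'
  refine ⟨isProbabilityMeasure_stationaryAge h h0 htop, ?_⟩
  have hlaw := hasLaw_prodMk_infinitePi Q.hasLaw_G Q.hasLaw_H Q.iIndepFun_G_H
  have hae : ∀ᵐ p ∂(Measure.infinitePi fun _ : ℕ => γ.prod η), (∃ n, p n ∈ deliveredSet) ∧
      Tendsto (fun N : ℕ => (∑ n ∈ Finset.range N, (p n).1) / (N : ℝ)) atTop
        (𝓝 (∫⁻ x, ENNReal.ofReal x ∂γ).toReal) ∧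
      ∀ x : ℚ, Tendsto (fun N : ℕ =>
        (∑ n ∈ Finset.range N, (timeBelow x (ageChain p n) (p n)).toReal) / N) atTop
        (𝓝 (∫⁻ b, ∫⁻ p, timeBelow x b p ∂γ.prod η ∂stationaryArrivalAge γ η).toReal) := by
    filter_upwards [ae_exists_mem_deliveredSet h, ae_tendsto_average_fst Q.nonneg_G htop,
      ae_all_iff.2 fun x : ℚ => ae_tendsto_average_timeBelow h Q.nonneg_G htop x]
      with p h1 h2 h3 using ⟨h1, h2, h3⟩
  rw [← hlaw.map_eq] at hae
  filter_upwards [ae_of_ae_map hlaw.aemeasurable hae, Q.ae_regular] with ω hω hreg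
  obtain ⟨⟨k, hk⟩, hG, hx⟩ := hω
  have hq : ∀ x : ℚ, Tendsto (fun T : ℝ =>
      T⁻¹ * ∫ t in (0 : ℝ)..T, {s | Q.aoi ω s ≤ x}.indicator (fun _ => (1 : ℝ)) t)
      atTop (𝓝 ((stationaryAge γ η).real (Set.Iic (x : ℝ)))) := by
    intro x
    have := hreg.tendsto_time_average hk (ENNReal.toReal_pos h0 htop) hG (hx x)
    rwa [measureReal_def, stationaryAge_Iic, ENNReal.toReal_mul, ENNReal.toReal_inv,
      inv_mul_eq_div]
  have hmono : ∀ {x y : ℝ}, x ≤ y → ∀ T : ℝ, 0 < T →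
      T⁻¹ * ∫ t in (0 : ℝ)..T, {s | Q.aoi ω s ≤ x}.indicator (fun _ => (1 : ℝ)) t ≤
      T⁻¹ * ∫ t in (0 : ℝ)..T, {s | Q.aoi ω s ≤ y}.indicator (fun _ => (1 : ℝ)) t := by
    intro x y hxy T hT
    refine mul_le_mul_of_nonneg_left ?_ (inv_nonneg.2 hT.le)
    refine intervalIntegral.integral_mono_on hT.le (hreg.intervalIntegrable_indicator x 0 T)
      (hreg.intervalIntegrable_indicator y 0 T) fun t _ => ?_
    exact Set.indicator_le_indicator_of_subset (fun s hs => le_trans hs hxy)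
      (fun _ => zero_le_one) t
  -- Convergence is known for rational levels only; monotonicity in the level and continuity of the
  -- limit give it for every x at the same ω.
  have hcont := continuous_stationaryAge_Iic h htop
  intro x
  refine tendsto_order.2 ⟨fun l hl => ?_, fun l hl => ?_⟩
  · obtain ⟨a, ha, hsub⟩ := exists_Ioc_subset_of_mem_nhds
      (hcont.continuousAt.eventually (lt_mem_nhds hl)) (exists_lt x)
    obtain ⟨y, hay, hyx⟩ := exists_rat_btwn ha
    filter_upwards [(hq y).eventually (lt_mem_nhds (hsub ⟨hay, hyx.le⟩)), eventually_gt_atTop 0]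
      with T hT hT0 using hT.trans_le (hmono hyx.le T hT0)
  · obtain ⟨a, ha, hsub⟩ := exists_Ico_subset_of_mem_nhds
      (hcont.continuousAt.eventually (gt_mem_nhds hl)) (exists_gt x)
    obtain ⟨y, hxy, hya⟩ := exists_rat_btwn ha
    filter_upwards [(hq y).eventually (gt_mem_nhds (hsub ⟨hxy.le, hya⟩)), eventually_gt_atTop 0]
      with T hT hT0 using (hmono hxy.le T hT0).trans_lt hT

/-- Two almost sure events share an outcome, at which both distribution functions are limits of the
same averages. Comparisons proved for `stationaryAge` thus hold for every stationary law. -/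
theorem IsStationaryAoI.eq {ν ν' : Measure ℝ}
    (h : Q.IsStationaryAoI ν) (h' : Q.IsStationaryAoI ν') : ν = ν' := by
  have := h.1
  have := h'.1
  obtain ⟨ω, h1, h2⟩ := (h.2.and h'.2).exists
  refine Measure.ext_of_Iic _ _ fun x => ?_
  have := tendsto_nhds_unique (h1 x) (h2 x)
  rwa [measureReal_def, measureReal_def,
    ENNReal.toReal_eq_toReal_iff' (measure_ne_top _ _) (measure_ne_top _ _)] at this

end PreemptiveLCFS

/-! ### Exponential laws -/

section Exponential

theorem lintegral_expMeasure (r : ℝ) {f : ℝ → ℝ≥0∞} (hf : Measurable f) :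
    ∫⁻ x, f x ∂expMeasure r = ∫⁻ x in Set.Ici 0, ENNReal.ofReal (r * Real.exp (-(r * x))) * f x := by
  have hpdf : Measurable (exponentialPDF r) := (measurable_exponentialPDFReal r).ennreal_ofReal
  have : expMeasure r = volume.withDensity (exponentialPDF r) := rfl
  rw [this, lintegral_withDensity_eq_lintegral_mul _ hpdf hf,
    ← lintegral_indicator measurableSet_Ici]
  refine lintegral_congr fun x => ?_
  by_cases hx : 0 ≤ x
  · simp [hx, exponentialPDF_of_nonneg hx]
  · simp [hx, exponentialPDF_of_neg (not_le.1 hx)]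

theorem expMeasure_Iic {r : ℝ} (hr : 0 < r) {x : ℝ} (hx : 0 ≤ x) :
    expMeasure r (Set.Iic x) = ENNReal.ofReal (1 - Real.exp (-(r * x))) := by
  have := isProbabilityMeasure_expMeasure hr
  rw [← ofReal_cdf, cdf_expMeasure_eq hr, if_pos hx]

theorem expMeasure_Ioi {r : ℝ} (hr : 0 < r) {x : ℝ} (hx : 0 ≤ x) :
    expMeasure r (Set.Ioi x) = ENNReal.ofReal (Real.exp (-(r * x))) := by
  have := isProbabilityMeasure_expMeasure hr
  rw [← Set.compl_Iic, prob_compl_eq_one_sub measurableSet_Iic, expMeasure_Iic hr hx,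
    ← ENNReal.ofReal_one, ← ENNReal.ofReal_sub _ (by simp; positivity), sub_sub_cancel]

theorem expMeasure_Ici {r : ℝ} (hr : 0 < r) {x : ℝ} (hx : 0 ≤ x) :
    expMeasure r (Set.Ici x) = ENNReal.ofReal (Real.exp (-(r * x))) := by
  have h : expMeasure r ≪ volume := withDensity_absolutelyContinuous _ _
  rw [← expMeasure_Ioi hr hx]
  exact measure_congr (h.ae_eq Ioi_ae_eq_Ici).symm

theorem lintegral_lintegral_Ico (γ : Measure ℝ) [SFinite γ] {F : ℝ → ℝ≥0∞} (hF : Measurable F) :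
    ∫⁻ g, (∫⁻ u in Set.Ico 0 g, F u) ∂γ = ∫⁻ u in Set.Ici 0, F u * γ (Set.Ioi u) := by
  have hS : MeasurableSet {z : ℝ × ℝ | 0 ≤ z.2 ∧ z.2 < z.1} :=
    (measurableSet_le measurable_const measurable_snd).inter
      (measurableSet_lt measurable_snd measurable_fst)
  have hm : Measurable ({z : ℝ × ℝ | 0 ≤ z.2 ∧ z.2 < z.1}.indicator fun z => F z.2) :=
    (hF.comp measurable_snd).indicator hS
  have h1 : ∀ g : ℝ, ∫⁻ u in Set.Ico 0 g, F u =
      ∫⁻ u, {z : ℝ × ℝ | 0 ≤ z.2 ∧ z.2 < z.1}.indicator (fun z => F z.2) (g, u) := fun g => by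
    rw [← lintegral_indicator measurableSet_Ico]; rfl
  simp_rw [h1]
  rw [lintegral_lintegral_swap (f := fun g u => {z : ℝ × ℝ | 0 ≤ z.2 ∧ z.2 < z.1}.indicator
    (fun z => F z.2) (g, u)) hm.aemeasurable, ← lintegral_indicator measurableSet_Ici]
  refine lintegral_congr fun u => ?_
  by_cases hu : 0 ≤ u
  · rw [Set.indicator_of_mem (show u ∈ Set.Ici 0 from hu), ← lintegral_indicator_const
      measurableSet_Ioi]
    refine lintegral_congr fun g => ?_
    by_cases hg : u < g <;> simp [Set.indicator, hu, hg]
  · simp [Set.indicator, hu]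

/-- The equilibrium law of an exponential law is the law itself. -/
theorem lintegral_lintegral_Ico_expMeasure {r : ℝ} (hr : 0 < r) {F : ℝ → ℝ≥0∞}
    (hF : Measurable F) : ∫⁻ g, (∫⁻ u in Set.Ico 0 g, F u) ∂expMeasure r =
      ENNReal.ofReal r⁻¹ * ∫⁻ u, F u ∂expMeasure r := by
  have := isProbabilityMeasure_expMeasure hr
  rw [lintegral_lintegral_Ico _ hF, lintegral_expMeasure r hF,
    ← lintegral_const_mul _ (by fun_prop)]
  refine setLIntegral_congr_fun measurableSet_Ici fun u hu => ?_
  rw [expMeasure_Ioi hr hu, ← mul_assoc, ← ENNReal.ofReal_mul (by positivity),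
    inv_mul_cancel_left₀ hr.ne', mul_comm]

theorem lintegral_ofReal_expMeasure {r : ℝ} (hr : 0 < r) :
    ∫⁻ x, ENNReal.ofReal x ∂expMeasure r = ENNReal.ofReal r⁻¹ := by
  have := isProbabilityMeasure_expMeasure hr
  have h := lintegral_lintegral_Ico_expMeasure hr (F := fun _ => 1) measurable_const
  simpa using h

end Exponential

/-! ### The mean age at arrivals -/

section MeanAge

variable {γ η : Measure ℝ} [IsProbabilityMeasure γ] [IsProbabilityMeasure η]

/-- Invariance applied to min(b, K) gives M ≤ E[G] + P(H > G) M for the truncated mean M. Truncation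
makes M finite, so that the last term can be cancelled. -/
theorem deliveredSet_mul_le_of_truncation (h : (γ.prod η) deliveredSet ≠ 0) (K : ℕ) :
    (γ.prod η) deliveredSet * ∫⁻ b, min (ENNReal.ofReal b) K ∂stationaryArrivalAge γ η ≤
      ∫⁻ x, ENNReal.ofReal x ∂γ := by
  have := isProbabilityMeasure_stationaryArrivalAge h
  set β := stationaryArrivalAge γ η
  set M := ∫⁻ b, min (ENNReal.ofReal b) K ∂β with hM
  have hMtop : M ≠ ∞ := by
    refine ne_top_of_le_ne_top (ENNReal.natCast_ne_top K) ?_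
    exact (lintegral_mono fun b => min_le_right _ _).trans (by simp)
  have hfix := lintegral_stationaryArrivalAge γ η
    (f := fun b => min (ENNReal.ofReal b) (K : ℝ≥0∞)) (by fun_prop)
  have hle : M ≤ (∫⁻ x, ENNReal.ofReal x ∂γ) + (γ.prod η) deliveredSetᶜ * M := by
    calc M ≤ ∫⁻ p in deliveredSet, ENNReal.ofReal p.1 ∂γ.prod η + ∫⁻ b, (∫⁻ p in deliveredSetᶜ,
          ENNReal.ofReal p.1 ∂γ.prod η + (γ.prod η) deliveredSetᶜ * min (ENNReal.ofReal b) K) ∂β := by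
          rw [hM, hfix]
          refine add_le_add (lintegral_mono fun p => min_le_left _ _) (lintegral_mono fun b => ?_)
          calc _ ≤ ∫⁻ p in deliveredSetᶜ, (ENNReal.ofReal p.1 + min (ENNReal.ofReal b) K)
                ∂γ.prod η := by
                refine lintegral_mono fun p => ?_
                rw [add_comm (ENNReal.ofReal p.1)]
                refine (min_le_min_right _ ENNReal.ofReal_add_le).trans ?_
                rcases le_total (ENNReal.ofReal b) K with hb | hb
                · rw [min_eq_left hb]; exact min_le_left _ _
                · rw [min_eq_right hb]; exact (min_le_right _ _).trans le_self_add
            _ = _ := by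
                rw [lintegral_add_right _ measurable_const, lintegral_const,
                  Measure.restrict_apply_univ, mul_comm (min _ _)]
      _ = _ := by
          rw [lintegral_add_left measurable_const, lintegral_const, measure_univ, mul_one,
            ← add_assoc, lintegral_add_compl _ measurableSet_deliveredSet,
            lintegral_prod_ofReal_fst, lintegral_const_mul _ (by fun_prop)]
  have hone : (γ.prod η) deliveredSet + (γ.prod η) deliveredSetᶜ = 1 := by
    rw [measure_add_measure_compl measurableSet_deliveredSet, measure_univ]
  have : (γ.prod η) deliveredSet * M + (γ.prod η) deliveredSetᶜ * M ≤
      (∫⁻ x, ENNReal.ofReal x ∂γ) + (γ.prod η) deliveredSetᶜ * M := by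
    rwa [← add_mul, hone, one_mul]
  exact (ENNReal.add_le_add_iff_right (ENNReal.mul_ne_top (measure_ne_top _ _) hMtop)).1 this

/-- Monotone convergence as K → ∞. The point is that the mean of β is finite, which permits the
cancellation behind the exact identity. -/
theorem deliveredSet_mul_lintegral_le (h : (γ.prod η) deliveredSet ≠ 0) :
    (γ.prod η) deliveredSet * ∫⁻ b, ENNReal.ofReal b ∂stationaryArrivalAge γ η ≤
      ∫⁻ x, ENNReal.ofReal x ∂γ := by
  have hsup : ∀ b : ℝ, ENNReal.ofReal b = ⨆ K : ℕ, min (ENNReal.ofReal b) K := by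
    intro b
    refine le_antisymm ?_ (iSup_le fun K => min_le_left _ _)
    obtain ⟨K, hK⟩ := ENNReal.exists_nat_gt (ENNReal.ofReal_ne_top (r := b))
    exact le_iSup_of_le K (by rw [min_eq_left hK.le])
  rw [lintegral_congr hsup, lintegral_iSup
    (f := fun (K : ℕ) (b : ℝ) => min (ENNReal.ofReal b) (K : ℝ≥0∞)) (fun K => by fun_prop)
    (fun K L hKL b => min_le_min_left _ (by exact_mod_cast hKL)), ENNReal.mul_iSup]
  exact iSup_le fun K => deliveredSet_mul_le_of_truncation h K

/-- The mean stationary age at arrivals is the mean interarrival time divided by the probability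
that a packet is delivered. -/
theorem deliveredSet_mul_lintegral_stationaryArrivalAge (h : (γ.prod η) deliveredSet ≠ 0)
    (hγ : ∀ᵐ x ∂γ, 0 ≤ x) (htop : ∫⁻ x, ENNReal.ofReal x ∂γ ≠ ∞) :
    (γ.prod η) deliveredSet * ∫⁻ b, ENNReal.ofReal b ∂stationaryArrivalAge γ η =
      ∫⁻ x, ENNReal.ofReal x ∂γ := by
  have := isProbabilityMeasure_stationaryArrivalAge h
  set β := stationaryArrivalAge γ η with hβ
  set M := ∫⁻ b, ENNReal.ofReal b ∂β with hM
  have hMtop : M ≠ ∞ := by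
    intro hM'
    have := deliveredSet_mul_lintegral_le h
    rw [← hβ, ← hM, hM', ENNReal.mul_top h, top_le_iff] at this
    exact htop this
  have hp : ∀ᵐ p ∂γ.prod η, 0 ≤ p.1 := Measure.quasiMeasurePreserving_fst.ae hγ
  have hb : ∀ᵐ b ∂β, 0 ≤ b := by
    rw [ae_iff, ← stationaryArrivalAge_Iio_zero h hγ]
    congr 1
    ext b
    simp
  have hfix : M = (∫⁻ x, ENNReal.ofReal x ∂γ) + (γ.prod η) deliveredSetᶜ * M := by
    calc M = ∫⁻ p in deliveredSet, ENNReal.ofReal p.1 ∂γ.prod η + ∫⁻ b, (∫⁻ p in deliveredSetᶜ,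
          ENNReal.ofReal p.1 ∂γ.prod η + (γ.prod η) deliveredSetᶜ * ENNReal.ofReal b) ∂β := by
          rw [hM, lintegral_stationaryArrivalAge γ η ENNReal.measurable_ofReal]
          congr 1
          refine lintegral_congr_ae ?_
          filter_upwards [hb] with b hb
          calc _ = ∫⁻ p in deliveredSetᶜ, (ENNReal.ofReal p.1 + ENNReal.ofReal b) ∂γ.prod η := by
                refine lintegral_congr_ae ?_
                filter_upwards [ae_restrict_of_ae hp] with p hp
                rw [add_comm b, ENNReal.ofReal_add hp hb]
            _ = _ := by
                rw [lintegral_add_right _ measurable_const, lintegral_const,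
                  Measure.restrict_apply_univ, mul_comm (ENNReal.ofReal b)]
      _ = _ := by
          rw [lintegral_add_left measurable_const, lintegral_const, measure_univ, mul_one,
            ← add_assoc, lintegral_add_compl _ measurableSet_deliveredSet,
            lintegral_prod_ofReal_fst, lintegral_const_mul _ ENNReal.measurable_ofReal]
  have hone : (γ.prod η) deliveredSet + (γ.prod η) deliveredSetᶜ = 1 := by
    rw [measure_add_measure_compl measurableSet_deliveredSet, measure_univ]
  have : (γ.prod η) deliveredSet * M + (γ.prod η) deliveredSetᶜ * M =
      (∫⁻ x, ENNReal.ofReal x ∂γ) + (γ.prod η) deliveredSetᶜ * M := by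
    rw [← add_mul, hone, one_mul]
    exact hfix
  exact (ENNReal.add_left_inj (ENNReal.mul_ne_top (measure_ne_top _ _) hMtop)).1 this

end MeanAge

/-! ### Poisson arrivals: the mean age -/

section PoissonArrivals

variable {r : ℝ} {η : Measure ℝ} [IsProbabilityMeasure η]

/-- Poisson arrivals see time averages. -/
theorem stationaryAge_expMeasure (hr : 0 < r) (h : ((expMeasure r).prod η) deliveredSet ≠ 0) :
    stationaryAge (expMeasure r) η = stationaryArrivalAge (expMeasure r) η := by
  have := isProbabilityMeasure_expMeasure hr
  have := isProbabilityMeasure_stationaryArrivalAge h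
  refine Measure.ext_of_lintegral _ fun f hf => ?_
  have hinv : (∫⁻ x, ENNReal.ofReal x ∂expMeasure r) ≠ 0 ∧
      (∫⁻ x, ENNReal.ofReal x ∂expMeasure r) ≠ ∞ := by
    rw [lintegral_ofReal_expMeasure hr]
    exact ⟨(ENNReal.ofReal_pos.2 (by positivity)).ne', ENNReal.ofReal_ne_top⟩
  -- Given the service time y, the elapsed time u is again exponential, and `sawtooth b y u` equals
  -- `ageStep b (u, y)`. The time average over an interval is thus one step of the chain, under
  -- which β is invariant.
  have key : ∀ b, ∫⁻ p, (∫⁻ u in Set.Ico 0 p.1, f (sawtooth b p.2 u)) ∂(expMeasure r).prod η =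
      (∫⁻ x, ENNReal.ofReal x ∂expMeasure r) * ∫⁻ p, f (ageStep b p) ∂(expMeasure r).prod η := by
    intro b
    have hS : MeasurableSet {z : (ℝ × ℝ) × ℝ | 0 ≤ z.2 ∧ z.2 < z.1.1} :=
      (measurableSet_le measurable_const measurable_snd).inter
        (measurableSet_lt measurable_snd (by fun_prop))
    have hF : Measurable fun z : (ℝ × ℝ) × ℝ => f (sawtooth b z.1.2 z.2) :=
      hf.comp (measurable_sawtooth.comp (f := fun z : (ℝ × ℝ) × ℝ => ((b, z.1), z.2)) (by fun_prop))
    have hm1 : Measurable fun p : ℝ × ℝ => ∫⁻ u in Set.Ico 0 p.1, f (sawtooth b p.2 u) := by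
      convert (hF.indicator hS).lintegral_prod_right' (ν := volume) using 2 with p
      rw [← lintegral_indicator measurableSet_Ico]
      rfl
    have hm2 : Measurable fun p : ℝ × ℝ => f (ageStep b p) :=
      hf.comp (measurable_ageStep.comp (measurable_const.prodMk measurable_id))
    rw [lintegral_prod_symm _ hm1.aemeasurable, lintegral_prod_symm _ hm2.aemeasurable,
      ← lintegral_const_mul _ hm2.lintegral_prod_left']
    refine lintegral_congr fun y => ?_
    dsimp only
    rw [lintegral_lintegral_Ico_expMeasure hr (F := fun u => f (sawtooth b y u)),
      lintegral_ofReal_expMeasure hr]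
    · congr 1
      refine lintegral_congr fun u => ?_
      simp only [sawtooth, ageStep]
      split_ifs <;> simp [add_comm]
    · exact hF.comp (f := fun u => ((0, y), u)) (by fun_prop)
  rw [lintegral_stationaryAge hf]
  simp_rw [key]
  have hm3 : Measurable fun b => ∫⁻ p, f (ageStep b p) ∂(expMeasure r).prod η :=
    (hf.comp measurable_ageStep).lintegral_prod_right'
  rw [lintegral_const_mul _ hm3, ← mul_assoc, ENNReal.inv_mul_cancel hinv.1 hinv.2, one_mul,
    lintegral_ageStep, ← lintegral_stationaryArrivalAge _ _ hf]

/-- Given H = x, delivery has probability exp(-rx). The delivery probability is therefore the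
Laplace transform of the service law at r, the mean of a convex function. -/
theorem expMeasure_prod_deliveredSet (hr : 0 < r) (hη : ∀ᵐ x ∂η, 0 ≤ x) :
    ((expMeasure r).prod η) deliveredSet = ∫⁻ x, ENNReal.ofReal (Real.exp (-(r * x))) ∂η := by
  have := isProbabilityMeasure_expMeasure hr
  rw [Measure.prod_apply_symm measurableSet_deliveredSet]
  refine lintegral_congr_ae ?_
  filter_upwards [hη] with x hx
  exact expMeasure_Ici hr hx

theorem integrable_exp_neg_mul (hr : 0 < r) (hη : ∀ᵐ x ∂η, 0 ≤ x) :
    Integrable (fun x => Real.exp (-(r * x))) η := by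
  refine Integrable.of_bound (by fun_prop) 1 ?_
  filter_upwards [hη] with x hx
  rw [Real.norm_eq_abs, Real.abs_exp, Real.exp_le_one_iff]
  simpa using mul_nonneg hr.le hx

theorem expMeasure_prod_deliveredSet_eq_ofReal (hr : 0 < r) (hη : ∀ᵐ x ∂η, 0 ≤ x) :
    ((expMeasure r).prod η) deliveredSet = ENNReal.ofReal (∫ x, Real.exp (-(r * x)) ∂η) := by
  rw [expMeasure_prod_deliveredSet hr hη, ofReal_integral_eq_lintegral_ofReal
    (integrable_exp_neg_mul hr hη) (.of_forall fun x => (Real.exp_pos _).le)]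

theorem expMeasure_prod_deliveredSet_ne_zero (hr : 0 < r) (hη : ∀ᵐ x ∂η, 0 ≤ x) :
    ((expMeasure r).prod η) deliveredSet ≠ 0 := by
  rw [expMeasure_prod_deliveredSet_eq_ofReal hr hη, ENNReal.ofReal_ne_zero_iff]
  exact integral_exp_pos (integrable_exp_neg_mul hr hη)

theorem ae_nonneg_stationaryAge_expMeasure (hr : 0 < r) (hη : ∀ᵐ x ∂η, 0 ≤ x)
    (hγ : ∀ᵐ x ∂expMeasure r, 0 ≤ x) : ∀ᵐ x ∂stationaryAge (expMeasure r) η, 0 ≤ x := by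
  have := isProbabilityMeasure_expMeasure hr
  have h := expMeasure_prod_deliveredSet_ne_zero hr hη
  rw [stationaryAge_expMeasure hr h, ae_iff, ← stationaryArrivalAge_Iio_zero h hγ]
  congr 1
  ext b
  simp

theorem mean_stationaryAge_expMeasure (hr : 0 < r) (hη : ∀ᵐ x ∂η, 0 ≤ x)
    (hγ : ∀ᵐ x ∂expMeasure r, 0 ≤ x) :
    Integrable (fun x : ℝ => x) (stationaryAge (expMeasure r) η) ∧
      (∫ x, Real.exp (-(r * x)) ∂η) * ∫ x, x ∂stationaryAge (expMeasure r) η = r⁻¹ := by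
  have := isProbabilityMeasure_expMeasure hr
  have h := expMeasure_prod_deliveredSet_ne_zero hr hη
  have hnn := ae_nonneg_stationaryAge_expMeasure hr hη hγ
  have heq := deliveredSet_mul_lintegral_stationaryArrivalAge h hγ
    (by rw [lintegral_ofReal_expMeasure hr]; exact ENNReal.ofReal_ne_top)
  rw [← stationaryAge_expMeasure hr h, lintegral_ofReal_expMeasure hr] at heq
  have hfin : ∫⁻ x, ENNReal.ofReal x ∂stationaryAge (expMeasure r) η ≠ ∞ := by
    intro htop
    rw [htop, ENNReal.mul_top h] at heq
    exact ENNReal.ofReal_ne_top heq.symm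
  refine ⟨(lintegral_ofReal_ne_top_iff_integrable aestronglyMeasurable_id hnn).1 hfin, ?_⟩
  rw [integral_eq_lintegral_of_nonneg_ae hnn aestronglyMeasurable_id]
  have := congrArg ENNReal.toReal heq
  rwa [ENNReal.toReal_mul, expMeasure_prod_deliveredSet_eq_ofReal hr hη,
    ENNReal.toReal_ofReal (integral_nonneg fun x => (Real.exp_pos _).le),
    ENNReal.toReal_ofReal (by positivity)] at this

/-- More variable service times reduce the mean age under Poisson arrivals. -/
theorem mean_stationaryAge_anti (hr : 0 < r) {η' : Measure ℝ} [IsProbabilityMeasure η']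
    (hη : ∀ᵐ x ∂η, 0 ≤ x) (hη' : ∀ᵐ x ∂η', 0 ≤ x) (hγ : ∀ᵐ x ∂expMeasure r, 0 ≤ x)
    (hcx : ConvexLE η η') :
    ∫ x, x ∂stationaryAge (expMeasure r) η' ≤ ∫ x, x ∂stationaryAge (expMeasure r) η := by
  have hconv : ConvexOn ℝ Set.univ fun x : ℝ => Real.exp (-(r * x)) := by
    have := convexOn_exp.comp_linearMap (LinearMap.lsmul ℝ ℝ (-r))
    refine this.congr fun x _ => ?_
    simp
  have hle := hcx.2.2.2 _ hconv (integrable_exp_neg_mul hr hη) (integrable_exp_neg_mul hr hη')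
  have h1 := (mean_stationaryAge_expMeasure hr hη hγ).2
  have h2 := (mean_stationaryAge_expMeasure hr hη' hγ).2
  have p1 : 0 < ∫ x, Real.exp (-(r * x)) ∂η := integral_exp_pos (integrable_exp_neg_mul hr hη)
  have p2 : 0 < ∫ x, Real.exp (-(r * x)) ∂η' := integral_exp_pos (integrable_exp_neg_mul hr hη')
  rw [mul_comm, ← eq_div_iff p1.ne'] at h1
  rw [mul_comm, ← eq_div_iff p2.ne'] at h2
  rw [h1, h2]
  gcongr

end PoissonArrivals

/-! ### Tail equations for general interarrival and service laws -/

section Tail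

variable {γ η : Measure ℝ} [IsProbabilityMeasure η]

theorem setLIntegral_deliveredSet_fst [SFinite γ] {F : ℝ → ℝ≥0∞} (hF : Measurable F) :
    ∫⁻ p in deliveredSet, F p.1 ∂γ.prod η = ∫⁻ g, F g * η (Set.Iic g) ∂γ := by
  rw [← lintegral_indicator measurableSet_deliveredSet,
    lintegral_prod _ (Measurable.indicator (by fun_prop) measurableSet_deliveredSet).aemeasurable]
  refine lintegral_congr fun g => ?_
  rw [← lintegral_indicator_const measurableSet_Iic]
  rfl

theorem setLIntegral_compl_deliveredSet_fst [SFinite γ] {F : ℝ → ℝ≥0∞} (hF : Measurable F) :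
    ∫⁻ p in deliveredSetᶜ, F p.1 ∂γ.prod η = ∫⁻ g, F g * η (Set.Ioi g) ∂γ := by
  rw [← lintegral_indicator measurableSet_deliveredSet.compl, lintegral_prod _
    (Measurable.indicator (by fun_prop) measurableSet_deliveredSet.compl).aemeasurable]
  refine lintegral_congr fun g => ?_
  rw [← lintegral_indicator_const measurableSet_Ioi]
  refine lintegral_congr fun y => ?_
  by_cases hy : y ≤ g <;> simp [Set.indicator, deliveredSet, hy]

variable [IsProbabilityMeasure γ]

theorem measurable_measure_Ioi (β : Measure ℝ) : Measurable fun y => β (Set.Ioi y) :=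
  Antitone.measurable fun _ _ h => measure_mono (Set.Ioi_subset_Ioi h)

theorem measurable_measure_Iic (β : Measure ℝ) : Measurable fun y => β (Set.Iic y) :=
  Monotone.measurable fun _ _ h => measure_mono (Set.Iic_subset_Iic.2 h)

theorem lintegral_indicator_Ioi_add (β : Measure ℝ) (x u : ℝ) :
    ∫⁻ b, (Set.Ioi x).indicator 1 (b + u) ∂β = β (Set.Ioi (x - u)) := by
  rw [← lintegral_indicator_one measurableSet_Ioi]
  refine lintegral_congr fun b => ?_
  simp [Set.indicator, sub_lt_iff_lt_add]

theorem measurable_indicator_Ioi (x : ℝ) : Measurable ((Set.Ioi x).indicator (1 : ℝ → ℝ≥0∞)) :=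
  measurable_one.indicator measurableSet_Ioi

/-- The renewal equation for the tail of the stationary age at arrivals. -/
theorem stationaryArrivalAge_Ioi (s : ℝ) : stationaryArrivalAge γ η (Set.Ioi s) =
    ∫⁻ g, (Set.Ioi s).indicator 1 g * η (Set.Iic g) ∂γ +
      ∫⁻ g, stationaryArrivalAge γ η (Set.Ioi (s - g)) * η (Set.Ioi g) ∂γ := by
  have hm := measurable_indicator_Ioi s
  conv_lhs => rw [← lintegral_indicator_one measurableSet_Ioi, lintegral_stationaryArrivalAge γ η hm]
  rw [setLIntegral_deliveredSet_fst hm]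
  congr 1
  have h1 : ∀ b, ∫⁻ p in deliveredSetᶜ, (Set.Ioi s).indicator (1 : ℝ → ℝ≥0∞) (b + p.1) ∂γ.prod η =
      ∫⁻ g, (Set.Ioi s).indicator 1 (b + g) * η (Set.Ioi g) ∂γ := fun b =>
    setLIntegral_compl_deliveredSet_fst (hm.comp (measurable_const_add b))
  have hη := measurable_measure_Ioi η
  simp_rw [h1]
  rw [lintegral_lintegral_swap (by
    refine Measurable.aemeasurable (.mul (hm.comp (f := fun z : ℝ × ℝ => z.1 + z.2) (by fun_prop)) ?_)
    exact hη.comp measurable_snd)]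
  refine lintegral_congr fun g => ?_
  have hmg : Measurable fun b => (Set.Ioi s).indicator (1 : ℝ → ℝ≥0∞) (b + g) :=
    hm.comp (measurable_add_const g)
  rw [lintegral_mul_const _ hmg, lintegral_indicator_Ioi_add]

/-- The time that the age spends in `(x, ∞)` during an interarrival interval. -/
theorem mul_stationaryAge_Ioi (h0 : ∫⁻ x, ENNReal.ofReal x ∂γ ≠ 0)
    (htop : ∫⁻ x, ENNReal.ofReal x ∂γ ≠ ∞) (x : ℝ) :
    (∫⁻ x, ENNReal.ofReal x ∂γ) * stationaryAge γ η (Set.Ioi x) =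
      ∫⁻ g, (∫⁻ u in Set.Ico 0 g, ((Set.Ioi x).indicator 1 u * η (Set.Iic u) *
          stationaryArrivalAge γ η Set.univ +
        stationaryArrivalAge γ η (Set.Ioi (x - u)) * η (Set.Ioi u))) ∂γ := by
  have hm := measurable_indicator_Ioi x
  set β := stationaryArrivalAge γ η
  have hIoi := measurable_measure_Ioi η
  have hIic := measurable_measure_Iic η
  rw [← lintegral_indicator_one measurableSet_Ioi, lintegral_stationaryAge hm, ← mul_assoc,
    ENNReal.mul_inv_cancel h0 htop, one_mul]
  have hT : Measurable fun z : (ℝ × ℝ × ℝ) × ℝ =>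
      (Set.Ioi x).indicator (1 : ℝ → ℝ≥0∞) (sawtooth z.1.1 z.1.2.2 z.2) :=
    hm.comp measurable_sawtooth
  have hadd := lintegral_indicator_Ioi_add β x
  generalize (Set.Ioi x).indicator (1 : ℝ → ℝ≥0∞) = I at hm hT hadd ⊢
  -- Integrating out the service time: at elapsed time u the packet has been delivered when y ≤ u
  -- and the age is u; otherwise it is b + u.
  have hk : ∀ b u, ∫⁻ y, I (sawtooth b y u) ∂η = I u * η (Set.Iic u) + I (b + u) * η (Set.Ioi u) := by
    intro b u
    rw [← lintegral_add_compl _ (measurableSet_Iic (a := u)), Set.compl_Iic,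
      setLIntegral_congr_fun measurableSet_Iic (g := fun _ => I u)
        fun y hy => by simp [sawtooth, Set.mem_Iic.1 hy],
      setLIntegral_congr_fun measurableSet_Ioi (g := fun _ => I (b + u))
        fun y hy => by simp [sawtooth, not_le.2 (Set.mem_Ioi.1 hy)]]
    simp
  have hpair : ∀ b, ∫⁻ p, (∫⁻ u in Set.Ico 0 p.1, I (sawtooth b p.2 u)) ∂γ.prod η =
      ∫⁻ u in Set.Ici 0, (I u * η (Set.Iic u) + I (b + u) * η (Set.Ioi u)) * γ (Set.Ioi u) := by
    intro b
    have hS : MeasurableSet {z : (ℝ × ℝ) × ℝ | 0 ≤ z.2 ∧ z.2 < z.1.1} :=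
      (measurableSet_le measurable_const measurable_snd).inter
        (measurableSet_lt measurable_snd (by fun_prop))
    have hF : Measurable fun z : (ℝ × ℝ) × ℝ => I (sawtooth b z.1.2 z.2) :=
      hT.comp (f := fun z : (ℝ × ℝ) × ℝ => ((b, z.1), z.2)) (by fun_prop)
    have hm1 : Measurable fun p : ℝ × ℝ => ∫⁻ u in Set.Ico 0 p.1, I (sawtooth b p.2 u) := by
      convert (hF.indicator hS).lintegral_prod_right' (ν := volume) using 2 with p
      rw [← lintegral_indicator measurableSet_Ico]
      rfl
    rw [lintegral_prod _ hm1.aemeasurable, ← lintegral_lintegral_Ico γ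
      (F := fun u => I u * η (Set.Iic u) + I (b + u) * η (Set.Ioi u))
      ((hm.mul hIic).add ((hm.comp (measurable_const_add b)).mul hIoi))]
    refine lintegral_congr fun g => ?_
    dsimp only
    rw [lintegral_lintegral_swap (f := fun y u => I (sawtooth b y u))]
    · exact lintegral_congr fun u => hk b u
    · exact (hF.comp (f := fun z : ℝ × ℝ => ((g, z.1), z.2)) (by fun_prop)).aemeasurable
  simp_rw [hpair]
  have hβ := measurable_measure_Ioi β
  have hγ := measurable_measure_Ioi γ
  rw [lintegral_lintegral_swap (f := fun b u =>
      (I u * η (Set.Iic u) + I (b + u) * η (Set.Ioi u)) * γ (Set.Ioi u)) ?_,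
    lintegral_lintegral_Ico γ (F := fun u => I u * η (Set.Iic u) * β Set.univ +
      β (Set.Ioi (x - u)) * η (Set.Ioi u)) (((hm.mul hIic).mul_const _).add
        ((hβ.comp (measurable_const.sub measurable_id)).mul hIoi))]
  · refine lintegral_congr fun u => ?_
    have hIu : Measurable fun b => I (b + u) := by fun_prop
    rw [lintegral_mul_const _ (by fun_prop), lintegral_add_left measurable_const, lintegral_const,
      lintegral_mul_const _ hIu, hadd]
  · have h1 : Measurable fun z : ℝ × ℝ => η (Set.Iic z.2) := hIic.comp measurable_snd
    have h2 : Measurable fun z : ℝ × ℝ => η (Set.Ioi z.2) := hIoi.comp measurable_snd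
    have h3 : Measurable fun z : ℝ × ℝ => γ (Set.Ioi z.2) := hγ.comp measurable_snd
    exact Measurable.aemeasurable ((((hm.comp measurable_snd).mul h1).add
      ((hm.comp (measurable_fst.add measurable_snd)).mul h2)).mul h3)

end Tail

/-! ### Exponential service: closed form of the tail -/

section ExponentialService

theorem lintegral_exp_mul_Iic {r : ℝ} (hr : 0 < r) (c : ℝ) :
    ∫⁻ s in Set.Iic c, ENNReal.ofReal (Real.exp (r * s)) =
      ENNReal.ofReal (Real.exp (r * c) / r) := by
  rw [← ofReal_integral_eq_lintegral_ofReal (integrableOn_exp_mul_Iic hr c)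
    (.of_forall fun s => (Real.exp_pos _).le), integral_exp_mul_Iic hr]

variable {γ : Measure ℝ} [IsProbabilityMeasure γ] {r : ℝ}

/-- Substitute s = x - u: then exp(rs) = exp(rx) exp(-ru), and exp(-ru) is the service tail at u. -/
theorem lintegral_Ioc_exp_mul {v : ℝ → ℝ≥0∞} (hr : 0 < r) (x g : ℝ) :
    ∫⁻ s in Set.Ioc (x - g) x, ENNReal.ofReal (Real.exp (r * s)) * v s =
      ENNReal.ofReal (Real.exp (r * x)) *
        ∫⁻ u in Set.Ico 0 g, v (x - u) * expMeasure r (Set.Ioi u) := by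
  rw [← lintegral_indicator measurableSet_Ioc, ← lintegral_sub_left_eq_self _ x,
    ← lintegral_const_mul' _ _ ENNReal.ofReal_ne_top, ← lintegral_indicator measurableSet_Ico]
  refine lintegral_congr fun u => ?_
  have hiff : x - u ∈ Set.Ioc (x - g) x ↔ u ∈ Set.Ico 0 g := by
    simp only [Set.mem_Ioc, Set.mem_Ico]
    constructor <;> rintro ⟨h1, h2⟩ <;> constructor <;> linarith
  by_cases hu : u ∈ Set.Ico 0 g
  · rw [Set.indicator_of_mem (hiff.2 hu), Set.indicator_of_mem hu, expMeasure_Ioi hr hu.1,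
      mul_comm (v _), ← mul_assoc, ← ENNReal.ofReal_mul (Real.exp_pos _).le, ← Real.exp_add]
    congr 4
    ring
  · rw [Set.indicator_of_notMem (mt hiff.1 hu), Set.indicator_of_notMem hu]

/-- This is why the weight exp(rs) is used: exp(rs) exp(-rg) = exp(r(s - g)), so the interruption
kernel acts on weighted integrals as a translation by g. -/
theorem lintegral_Iic_exp_mul_sub {v : ℝ → ℝ≥0∞} (hr : 0 < r) (x : ℝ) {g : ℝ} (hg : 0 ≤ g) :
    ∫⁻ s in Set.Iic x, ENNReal.ofReal (Real.exp (r * s)) * (v (s - g) * expMeasure r (Set.Ioi g)) =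
      ∫⁻ s in Set.Iic (x - g), ENNReal.ofReal (Real.exp (r * s)) * v s := by
  rw [← lintegral_indicator measurableSet_Iic, ← lintegral_indicator measurableSet_Iic,
    ← lintegral_sub_right_eq_self ((Set.Iic (x - g)).indicator _) g]
  refine lintegral_congr fun s => ?_
  have hiff : s - g ∈ Set.Iic (x - g) ↔ s ∈ Set.Iic x := by simp
  by_cases hs : s ∈ Set.Iic x
  · rw [Set.indicator_of_mem (hiff.2 hs), Set.indicator_of_mem hs, expMeasure_Ioi hr hg,
      mul_comm (v _), ← mul_assoc, ← ENNReal.ofReal_mul (Real.exp_pos _).le, ← Real.exp_add]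
    congr 4
    ring
  · rw [Set.indicator_of_notMem (mt hiff.1 hs), Set.indicator_of_notMem hs]

theorem lintegral_Iic_exp_mul_indicator (hr : 0 < r) (x : ℝ) {g : ℝ} (hg : 0 ≤ g) :
    ∫⁻ s in Set.Iic x, ENNReal.ofReal (Real.exp (r * s)) *
        ((Set.Ioi s).indicator 1 g * expMeasure r (Set.Iic g)) =
      ENNReal.ofReal ((1 - Real.exp (-(r * g))) * (Real.exp (r * min x g) / r)) := by
  have hexp : 0 ≤ 1 - Real.exp (-(r * g)) := by
    rw [sub_nonneg, Real.exp_le_one_iff]; simpa using mul_nonneg hr.le hg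
  rw [ENNReal.ofReal_mul hexp, ← lintegral_exp_mul_Iic hr, ← expMeasure_Iic hr hg,
    ← lintegral_const_mul _ (by fun_prop), ← lintegral_indicator measurableSet_Iic,
    ← lintegral_indicator measurableSet_Iic]
  refine lintegral_congr_ae ?_
  -- The tail indicator requires s < g while the integral up to min(x, g) allows s = g; that single
  -- point is discarded.
  have hne : ∀ᵐ s : ℝ, s ≠ g := by simp [ae_iff]
  filter_upwards [hne] with s hs
  simp only [Set.indicator, Set.mem_Iic, Set.mem_Ioi, le_min_iff, Pi.one_apply]
  by_cases h1 : s ≤ x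
  · rcases lt_or_gt_of_ne hs with h2 | h2
    · simp [h1, h2, h2.le, mul_comm]
    · simp [h1, not_lt.2 h2.le, not_le.2 h2]
  · simp [h1]

/-- With exponential service times, the renewal equation for the tail of the age at arrivals gives
the time average of that age in closed form. -/
theorem exp_mul_lintegral_stationaryArrivalAge_Ioi (hr : 0 < r) (hγ : ∀ᵐ x ∂γ, 0 ≤ x)
    (h : (γ.prod (expMeasure r)) deliveredSet ≠ 0) (x : ℝ) :
    ENNReal.ofReal (Real.exp (r * x)) * ∫⁻ g, (∫⁻ u in Set.Ico 0 g,
        stationaryArrivalAge γ (expMeasure r) (Set.Ioi (x - u)) * expMeasure r (Set.Ioi u)) ∂γ =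
      ∫⁻ g, ENNReal.ofReal ((1 - Real.exp (-(r * g))) * (Real.exp (r * min x g) / r)) ∂γ := by
  have := isProbabilityMeasure_expMeasure hr
  have := isProbabilityMeasure_stationaryArrivalAge h
  have hη := measurable_measure_Ioi (expMeasure r)
  have hη' := measurable_measure_Iic (expMeasure r)
  have hvm := measurable_measure_Ioi (stationaryArrivalAge γ (expMeasure r))
  have hren := fun s => stationaryArrivalAge_Ioi (γ := γ) (η := expMeasure r) s
  have hv1 : ∀ s, stationaryArrivalAge γ (expMeasure r) (Set.Ioi s) ≤ 1 := fun s => prob_le_one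
  set v : ℝ → ℝ≥0∞ := fun s => stationaryArrivalAge γ (expMeasure r) (Set.Ioi s) with hv
  set V : ℝ → ℝ≥0∞ := fun y => ∫⁻ s in Set.Iic y, ENNReal.ofReal (Real.exp (r * s)) * v s with hV
  have hVtop : V x ≠ ∞ := by
    refine ne_top_of_le_ne_top (ENNReal.ofReal_ne_top (r := Real.exp (r * x) / r)) ?_
    rw [← lintegral_exp_mul_Iic hr]
    exact lintegral_mono fun s => mul_le_of_le_one_right' (hv1 s)
  have hVm : Measurable V := Monotone.measurable fun a b hab =>
    lintegral_mono_set (Set.Iic_subset_Iic.2 hab)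
  -- Splitting (-∞, x] at x - g, and integrating the renewal equation over (-∞, x], give two
  -- expressions for V x with the same unknown E[V(x - G)]. It is finite, so it cancels and equates
  -- the remaining terms.
  have hsplit : V x = ∫⁻ g, V (x - g) ∂γ + ENNReal.ofReal (Real.exp (r * x)) *
      ∫⁻ g, (∫⁻ u in Set.Ico 0 g, v (x - u) * expMeasure r (Set.Ioi u)) ∂γ := by
    have hVs : Measurable fun g => V (x - g) := hVm.comp (measurable_const_sub x)
    rw [← lintegral_const_mul' _ _ ENNReal.ofReal_ne_top, ← lintegral_add_left hVs]
    trans ∫⁻ g, V x ∂γ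
    · simp
    · refine lintegral_congr_ae ?_
      filter_upwards [hγ] with g hg
      rw [← lintegral_Ioc_exp_mul hr, hV]
      dsimp only
      rw [← lintegral_union measurableSet_Ioc (Set.Iic_disjoint_Ioc le_rfl),
        Set.Iic_union_Ioc_eq_Iic (by linarith)]
  have hrenew : V x = ∫⁻ g, V (x - g) ∂γ +
      ∫⁻ g, ENNReal.ofReal ((1 - Real.exp (-(r * g))) * (Real.exp (r * min x g) / r)) ∂γ := by
    have hexp : Measurable fun s : ℝ => ENNReal.ofReal (Real.exp (r * s)) := by fun_prop
    have hm1 : Measurable fun z : ℝ × ℝ => ENNReal.ofReal (Real.exp (r * z.1)) *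
        ((Set.Ioi z.1).indicator 1 z.2 * expMeasure r (Set.Iic z.2)) := by
      refine (hexp.comp measurable_fst).mul (.mul ?_ (hη'.comp measurable_snd))
      exact Measurable.indicator (s := {z : ℝ × ℝ | z.1 < z.2}) measurable_const
        (measurableSet_lt measurable_fst measurable_snd)
    have hm2 : Measurable fun z : ℝ × ℝ => ENNReal.ofReal (Real.exp (r * z.1)) *
        (v (z.1 - z.2) * expMeasure r (Set.Ioi z.2)) :=
      (hexp.comp measurable_fst).mul
        ((hvm.comp (measurable_fst.sub measurable_snd)).mul (hη.comp measurable_snd))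
    calc V x = ∫⁻ s in Set.Iic x, (∫⁻ g, ENNReal.ofReal (Real.exp (r * s)) *
            ((Set.Ioi s).indicator 1 g * expMeasure r (Set.Iic g)) ∂γ +
          ∫⁻ g, ENNReal.ofReal (Real.exp (r * s)) *
            (v (s - g) * expMeasure r (Set.Ioi g)) ∂γ) := by
          refine lintegral_congr fun s => ?_
          rw [lintegral_const_mul' _ _ ENNReal.ofReal_ne_top,
            lintegral_const_mul' _ _ ENNReal.ofReal_ne_top, ← mul_add]
          congr 1
          exact hren s
      _ = ∫⁻ g, (∫⁻ s in Set.Iic x, ENNReal.ofReal (Real.exp (r * s)) *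
            ((Set.Ioi s).indicator 1 g * expMeasure r (Set.Iic g))) ∂γ +
          ∫⁻ g, (∫⁻ s in Set.Iic x, ENNReal.ofReal (Real.exp (r * s)) *
            (v (s - g) * expMeasure r (Set.Ioi g))) ∂γ := by
          have hm1' : Measurable fun s => ∫⁻ g, ENNReal.ofReal (Real.exp (r * s)) *
              ((Set.Ioi s).indicator 1 g * expMeasure r (Set.Iic g)) ∂γ := hm1.lintegral_prod_right'
          rw [lintegral_add_left hm1', lintegral_lintegral_swap (f := fun s g =>
            ENNReal.ofReal (Real.exp (r * s)) * ((Set.Ioi s).indicator 1 g *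
              expMeasure r (Set.Iic g))) hm1.aemeasurable, lintegral_lintegral_swap (f := fun s g =>
            ENNReal.ofReal (Real.exp (r * s)) * (v (s - g) * expMeasure r (Set.Ioi g)))
              hm2.aemeasurable]
      _ = _ := by
          rw [add_comm]
          congr 1
          · refine lintegral_congr_ae ?_
            filter_upwards [hγ] with g hg using lintegral_Iic_exp_mul_sub hr x hg
          · refine lintegral_congr_ae ?_
            filter_upwards [hγ] with g hg using lintegral_Iic_exp_mul_indicator hr x hg
  have hfin : ∫⁻ g, V (x - g) ∂γ ≠ ∞ :=
    ne_top_of_le_ne_top hVtop (hrenew ▸ le_self_add)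
  exact (ENNReal.add_right_inj hfin).1 (hsplit.symm.trans hrenew)

/-- The function whose mean under the interarrival law is the mean time that the age spends above
`x` during an interarrival interval, when the service times are exponential of rate `r`. -/
noncomputable def timeAboveMean (r x g : ℝ) : ℝ :=
  Real.exp (-(r * x)) * (Real.exp (r * min x g) - 1) / r + max (g - x) 0

theorem lintegral_Ico_indicator_mul_expMeasure_Iic (hr : 0 < r) {x : ℝ} (hx : 0 ≤ x) (g : ℝ) :
    ∫⁻ u in Set.Ico 0 g, (Set.Ioi x).indicator 1 u * expMeasure r (Set.Iic u) =
      ENNReal.ofReal (if x < g then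
        g - x - (Real.exp (-(r * x)) - Real.exp (-(r * g))) / r else 0) := by
  have h1 : ∫⁻ u in Set.Ico 0 g, (Set.Ioi x).indicator 1 u * expMeasure r (Set.Iic u) =
      ∫⁻ u in Set.Ioo x g, ENNReal.ofReal (1 - Real.exp (-(r * u))) := by
    rw [← lintegral_indicator measurableSet_Ico, ← lintegral_indicator measurableSet_Ioo]
    refine lintegral_congr fun u => ?_
    by_cases hu : x < u
    · have hu0 : 0 ≤ u := hx.trans hu.le
      simp [Set.indicator, hu, hu0, expMeasure_Iic hr hu0]
    · simp [Set.indicator, hu]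
  rw [h1]
  split_ifs with hxg
  · have hcont : Continuous fun u => 1 - Real.exp (-(r * u)) := by fun_prop
    have hint : IntegrableOn (fun u => 1 - Real.exp (-(r * u))) (Set.Ioo x g) :=
      (hcont.integrableOn_Icc).mono_set Set.Ioo_subset_Icc_self
    rw [← ofReal_integral_eq_lintegral_ofReal hint, ← integral_Ioc_eq_integral_Ioo,
      ← intervalIntegral.integral_of_le hxg.le]
    · congr 1
      rw [intervalIntegral.integral_eq_sub_of_hasDerivAt
        (f := fun u => u + Real.exp (-(r * u)) / r) _ (hcont.intervalIntegrable _ _)]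
      · ring
      · intro u _
        have h2 : HasDerivAt (fun u => -(r * u)) (-r) u := by
          simpa using ((hasDerivAt_id' u).const_mul r).fun_neg
        convert (hasDerivAt_id' u).fun_add (h2.exp.div_const r) using 1
        rw [mul_neg, neg_div, mul_div_cancel_right₀ _ hr.ne', sub_eq_add_neg]
    · refine (ae_restrict_iff' measurableSet_Ioo).2 (.of_forall fun u hu => ?_)
      simp only [Pi.zero_apply, sub_nonneg, Real.exp_le_one_iff]
      have : 0 ≤ r * u := mul_nonneg hr.le (hx.trans hu.1.le)
      linarith
  · rw [Set.Ioo_eq_empty hxg]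
    simp

/-- The time above x comes either from a packet already delivered, which is an elementary integral,
or from the age carried over from earlier packets, given by
`exp_mul_lintegral_stationaryArrivalAge_Ioi`. For x < g the terms in exp(-rg) of the two parts
cancel; for g ≤ x only the second part is present. -/
theorem mul_stationaryAge_Ioi_eq_lintegral (hr : 0 < r) (hγ : ∀ᵐ x ∂γ, 0 ≤ x)
    (h : (γ.prod (expMeasure r)) deliveredSet ≠ 0) (h0 : ∫⁻ x, ENNReal.ofReal x ∂γ ≠ 0)
    (htop : ∫⁻ x, ENNReal.ofReal x ∂γ ≠ ∞) {x : ℝ} (hx : 0 ≤ x) :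
    (∫⁻ x, ENNReal.ofReal x ∂γ) * stationaryAge γ (expMeasure r) (Set.Ioi x) =
      ∫⁻ g, ENNReal.ofReal (timeAboveMean r x g) ∂γ := by
  have := isProbabilityMeasure_expMeasure hr
  have := isProbabilityMeasure_stationaryArrivalAge h
  have hJ := exp_mul_lintegral_stationaryArrivalAge_Ioi hr hγ h x
  have hJ' := congrArg (ENNReal.ofReal (Real.exp (-(r * x))) * ·) hJ
  simp only [← mul_assoc] at hJ'
  rw [← ENNReal.ofReal_mul (Real.exp_pos _).le, ← Real.exp_add, neg_add_cancel, Real.exp_zero,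
    ENNReal.ofReal_one, one_mul] at hJ'
  have hmI : Measurable fun u => (Set.Ioi x).indicator (1 : ℝ → ℝ≥0∞) u * expMeasure r (Set.Iic u) :=
    (measurable_indicator_Ioi x).mul (measurable_measure_Iic _)
  have hκ : Measurable fun g => ENNReal.ofReal (if x < g then
      g - x - (Real.exp (-(r * x)) - Real.exp (-(r * g))) / r else 0) :=
    (Measurable.ite measurableSet_Ioi (by fun_prop) measurable_const).ennreal_ofReal
  rw [mul_stationaryAge_Ioi h0 htop]
  simp only [measure_univ, mul_one]
  simp_rw [lintegral_add_left hmI, lintegral_Ico_indicator_mul_expMeasure_Iic hr hx]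
  rw [lintegral_add_left hκ, hJ', ← lintegral_const_mul' _ _ ENNReal.ofReal_ne_top,
    ← lintegral_add_left hκ]
  · refine lintegral_congr_ae ?_
    filter_upwards [hγ] with g hg
    have hexp : 0 ≤ 1 - Real.exp (-(r * g)) := by
      rw [sub_nonneg, Real.exp_le_one_iff]; simpa using mul_nonneg hr.le hg
    rw [← ENNReal.ofReal_mul (Real.exp_pos _).le, ← ENNReal.ofReal_add _ (by positivity)]
    · congr 1
      unfold timeAboveMean
      split_ifs with hxg
      · have e : Real.exp (-(r * x)) * Real.exp (r * x) = 1 := by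
          rw [← Real.exp_add, neg_add_cancel, Real.exp_zero]
        rw [min_eq_left hxg.le, max_eq_left (by linarith)]
        generalize Real.exp (-(r * x)) = a at e ⊢
        generalize Real.exp (r * x) = b at e ⊢
        generalize Real.exp (-(r * g)) = c
        field_simp
        linear_combination (-c) * e
      · have e : Real.exp (-(r * g)) * Real.exp (r * g) = 1 := by
          rw [← Real.exp_add, neg_add_cancel, Real.exp_zero]
        rw [min_eq_right (not_lt.1 hxg), max_eq_right (by linarith [not_lt.1 hxg])]
        generalize Real.exp (-(r * g)) = c at e ⊢
        generalize Real.exp (-(r * x)) = a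
        field_simp
        linear_combination (-a) * e
    · split_ifs with hxg
      -- This is exp(-rx)(1 - exp(-t)) ≤ t with t = r(g - x) ≥ 0.
      · have h2 : Real.exp (-(r * x)) - Real.exp (-(r * g)) ≤ r * (g - x) := by
          have h3 : Real.exp (-(r * g)) = Real.exp (-(r * x)) * Real.exp (-(r * (g - x))) := by
            rw [← Real.exp_add]; congr 1; ring
          have h4 := Real.add_one_le_exp (-(r * (g - x)))
          have h5 : Real.exp (-(r * x)) ≤ 1 := by
            rw [Real.exp_le_one_iff]; simpa using mul_nonneg hr.le hx
          have h6 : 0 ≤ r * (g - x) := mul_nonneg hr.le (by linarith)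
          rw [h3]
          nlinarith [Real.exp_pos (-(r * x))]
        rw [sub_nonneg, div_le_iff₀ hr]
        linarith
      · exact le_rfl

end ExponentialService

/-! ### Convexity in the interarrival time -/

theorem convexOn_univ_of_subgradient {φ : ℝ → ℝ} (h : ∀ y, ∃ k, ∀ z, φ y + k * (z - y) ≤ φ z) :
    ConvexOn ℝ Set.univ φ := by
  refine ⟨convex_univ, fun u _ w _ a b ha hb hab => ?_⟩
  obtain ⟨k, hk⟩ := h (a • u + b • w)
  have h1 := mul_le_mul_of_nonneg_left (hk u) ha
  have h2 := mul_le_mul_of_nonneg_left (hk w) hb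
  simp only [smul_eq_mul] at h1 h2 ⊢
  obtain rfl : b = 1 - a := by linarith
  nlinarith

section TimeAboveMean

variable {r : ℝ}

/-- The slope in g is exp(r(g - x)) up to x, where it reaches 1, and stays 1 afterwards, so it is
non-decreasing. The supporting line with this slope is checked separately on the two parts of g =
min(x, g) + (g - x)⁺. -/
theorem convexOn_timeAboveMean (hr : 0 < r) (x : ℝ) :
    ConvexOn ℝ Set.univ (timeAboveMean r x) := by
  refine convexOn_univ_of_subgradient fun y => ⟨Real.exp (r * (min x y - x)), fun z => ?_⟩
  have hform : ∀ w, timeAboveMean r x w =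
      Real.exp (r * (min x w - x)) / r - Real.exp (-(r * x)) / r + max (w - x) 0 := by
    intro w
    have : Real.exp (r * (min x w - x)) = Real.exp (-(r * x)) * Real.exp (r * min x w) := by
      rw [← Real.exp_add]; congr 1; ring
    rw [this, timeAboveMean]
    ring
  have hsum : ∀ w, w = min x w + max (w - x) 0 := by
    intro w
    rcases le_total x w with h | h
    · rw [min_eq_left h, max_eq_left (by linarith)]; ring
    · rw [min_eq_right h, max_eq_right (by linarith)]; ring
  rw [hform, hform]
  have htan : Real.exp (r * (min x y - x)) / r +
      Real.exp (r * (min x y - x)) * (min x z - min x y) ≤ Real.exp (r * (min x z - x)) / r := by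
    have h1 : Real.exp (r * (min x z - x)) =
        Real.exp (r * (min x y - x)) * Real.exp (r * (min x z - min x y)) := by
      rw [← Real.exp_add]; congr 1; ring
    rw [h1, le_div_iff₀ hr, add_mul, div_mul_cancel₀ _ hr.ne']
    nlinarith [Real.add_one_le_exp (r * (min x z - min x y)), Real.exp_pos (r * (min x y - x))]
  -- For y ≥ x the slope is exactly 1; for y ≤ x it is at most 1 and the increment of the positive
  -- part is non-negative.
  have hslope : Real.exp (r * (min x y - x)) * (max (z - x) 0 - max (y - x) 0) ≤
      max (z - x) 0 - max (y - x) 0 := by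
    rcases le_total x y with h | h
    · simp [min_eq_left h]
    · rw [max_eq_right (show y - x ≤ 0 by linarith), sub_zero]
      refine mul_le_of_le_one_left (le_max_right _ _) (Real.exp_le_one_iff.2 ?_)
      exact mul_nonpos_of_nonneg_of_nonpos hr.le (by linarith [min_le_left x y])
  have hz := hsum z
  have hy := hsum y
  have hzy : z - y = (min x z - min x y) + (max (z - x) 0 - max (y - x) 0) := by linarith
  rw [hzy, mul_add]
  linarith

theorem timeAboveMean_nonneg (hr : 0 < r) {x g : ℝ} (hx : 0 ≤ x) (hg : 0 ≤ g) :
    0 ≤ timeAboveMean r x g := by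
  have : 1 ≤ Real.exp (r * min x g) := Real.one_le_exp (mul_nonneg hr.le (le_min hx hg))
  exact add_nonneg (div_nonneg (mul_nonneg (Real.exp_pos _).le (by linarith)) hr.le)
    (le_max_right _ _)

theorem integrable_timeAboveMean (hr : 0 < r) (x : ℝ) {γ : Measure ℝ} [IsFiniteMeasure γ]
    (hγ : Integrable (fun x : ℝ => x) γ) : Integrable (timeAboveMean r x) γ := by
  have h1 : Integrable (fun g => Real.exp (r * min x g)) γ := by
    refine Integrable.of_bound (by fun_prop) (Real.exp (r * x)) (.of_forall fun g => ?_)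
    rw [Real.norm_eq_abs, Real.abs_exp]
    gcongr
    exact min_le_left _ _
  exact (((h1.sub (integrable_const 1)).const_mul _).div_const r).add
    (hγ.sub (integrable_const x)).pos_part

end TimeAboveMean

/-! ### Stochastic order from distribution functions -/

section StochasticOrder

variable {μ ν : Measure ℝ}

/-- A lower set with a greatest element a is (-∞, a]. Otherwise it is the countable directed union
of the (-∞, q] over its rational elements q, and continuity from below applies. -/
theorem measure_le_of_isLowerSet (h : ∀ x, ν (Set.Iic x) ≤ μ (Set.Iic x)) {L : Set ℝ}
    (hL : IsLowerSet L) : ν L ≤ μ L := by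
  by_cases hmax : ∃ a, IsGreatest L a
  · obtain ⟨a, ha⟩ := hmax
    rw [Set.Subset.antisymm (fun x hx => ha.2 hx) fun x hx => hL hx ha.1]
    exact h a
  · have hU : L = ⋃ q : {q : ℚ // (q : ℝ) ∈ L}, Set.Iic ((q : ℚ) : ℝ) := by
      ext x
      simp only [Set.mem_iUnion, Set.mem_Iic, Subtype.exists, exists_prop]
      refine ⟨fun hx => ?_, fun ⟨q, hq, hxq⟩ => hL hxq hq⟩
      by_contra! hcon
      refine hmax ⟨x, hx, fun y hy => ?_⟩
      by_contra! hxy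
      obtain ⟨q, hxq, hqy⟩ := exists_rat_btwn hxy
      exact absurd hxq (not_lt.2 (hcon q (hL hqy.le hy)).le)
    have hd : Directed (· ⊆ ·) fun q : {q : ℚ // (q : ℝ) ∈ L} => Set.Iic ((q : ℚ) : ℝ) :=
      Monotone.directed_le fun p q hpq => Set.Iic_subset_Iic.2 (by exact_mod_cast hpq)
    rw [hU, hd.measure_iUnion, hd.measure_iUnion]
    exact iSup_mono fun q => h q

theorem measure_le_of_isUpperSet [IsProbabilityMeasure μ] [IsProbabilityMeasure ν]
    (h : ∀ x, ν (Set.Iic x) ≤ μ (Set.Iic x)) {U : Set ℝ} (hU : IsUpperSet U) : μ U ≤ ν U := by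
  have hm : MeasurableSet U := hU.ordConnected.measurableSet
  have := measure_le_of_isLowerSet h hU.compl
  rw [prob_compl_eq_one_sub hm, prob_compl_eq_one_sub hm] at this
  exact (ENNReal.sub_le_sub_iff_left prob_le_one ENNReal.one_ne_top).1 this

/-- Ordered distribution functions give the stochastic order. -/
theorem stochLE_of_measure_Iic_le [IsProbabilityMeasure μ] [IsProbabilityMeasure ν]
    (h : ∀ x, ν (Set.Iic x) ≤ μ (Set.Iic x)) : StochLE μ ν := by
  intro φ hφ hμ hν
  -- Layer-cake formula: for monotone φ the level sets {φ > t} are upper sets and {-φ > t} lower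
  -- sets, so positive and negative parts are compared level by level.
  have layer : ∀ (κ : Measure ℝ) (f : ℝ → ℝ), Measurable f → ∫⁻ x, ENNReal.ofReal (f x) ∂κ =
      ∫⁻ t in Set.Ioi 0, κ {x | t < f x} := by
    intro κ f hf
    have := lintegral_eq_lintegral_meas_lt κ (f := fun x => max (f x) 0)
      (.of_forall fun x => le_max_right _ _) (by fun_prop)
    simp only [ENNReal.ofReal_max, ENNReal.ofReal_zero, max_eq_left zero_le] at this
    rw [this]
    refine setLIntegral_congr_fun measurableSet_Ioi fun t ht => ?_
    congr 1
    ext x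
    simp [not_lt.2 (le_of_lt (Set.mem_Ioi.1 ht))]
  rw [integral_eq_lintegral_pos_part_sub_lintegral_neg_part hμ,
    integral_eq_lintegral_pos_part_sub_lintegral_neg_part hν]
  refine sub_le_sub (ENNReal.toReal_mono hν.lintegral_lt_top.ne ?_)
    (ENNReal.toReal_mono hμ.neg.lintegral_lt_top.ne ?_)
  · rw [layer _ _ hφ.measurable, layer _ _ hφ.measurable]
    exact lintegral_mono fun t => measure_le_of_isUpperSet h
      fun x y hxy (hx : t < φ x) => hx.trans_le (hφ hxy)
  · have hneg : Measurable fun x => -φ x := hφ.measurable.neg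
    rw [layer ν _ hneg, layer μ _ hneg]
    exact lintegral_mono fun t => measure_le_of_isLowerSet h
      fun x y hxy (hx : t < -φ x) => hx.trans_le (neg_le_neg (hφ hxy))

end StochasticOrder

/-! ### Exponential service: comparison of the ages -/

section ExponentialServiceOrder

variable {γ : Measure ℝ} [IsProbabilityMeasure γ] {r : ℝ}

/-- Given G = g > 0, delivery has probability 1 - exp(-rg) > 0. A vanishing delivery probability
would force G ≤ 0 almost surely, against the positive mean. -/
theorem prod_expMeasure_deliveredSet_ne_zero (hr : 0 < r)
    (h0 : ∫⁻ x, ENNReal.ofReal x ∂γ ≠ 0) : (γ.prod (expMeasure r)) deliveredSet ≠ 0 := by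
  have := isProbabilityMeasure_expMeasure hr
  intro h
  refine h0 ?_
  have h1 := setLIntegral_deliveredSet_fst (γ := γ) (η := expMeasure r) (F := 1) measurable_one
  simp only [Pi.one_apply, lintegral_one, Measure.restrict_apply_univ, h, one_mul] at h1
  rw [eq_comm, lintegral_eq_zero_iff (measurable_measure_Iic _)] at h1
  rw [lintegral_eq_zero_iff (by fun_prop)]
  filter_upwards [h1] with g hg
  by_contra hne
  have hg0 : 0 < g := by
    by_contra! hle
    exact hne (ENNReal.ofReal_of_nonpos hle)
  rw [expMeasure_Iic hr hg0.le, Pi.zero_apply, ENNReal.ofReal_eq_zero, sub_nonpos,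
    Real.one_le_exp_iff] at hg
  have := mul_pos hr hg0
  linarith

theorem stationaryAge_Iio_zero {η : Measure ℝ} [IsProbabilityMeasure η]
    (h : (γ.prod η) deliveredSet ≠ 0) (hγ : ∀ᵐ x ∂γ, 0 ≤ x) :
    stationaryAge γ η (Set.Iio 0) = 0 := by
  rw [← lintegral_indicator_one measurableSet_Iio,
    lintegral_stationaryAge (measurable_one.indicator measurableSet_Iio)]
  have hb : ∀ᵐ b ∂stationaryArrivalAge γ η, 0 ≤ b := by
    rw [ae_iff, ← stationaryArrivalAge_Iio_zero h hγ]
    congr 1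
    ext b
    simp
  have hz : ∫⁻ b, ∫⁻ p, (∫⁻ u in Set.Ico 0 p.1,
      (Set.Iio (0 : ℝ)).indicator (1 : ℝ → ℝ≥0∞) (sawtooth b p.2 u)) ∂γ.prod η
      ∂stationaryArrivalAge γ η = 0 := by
    rw [lintegral_congr_ae (g := 0)]
    · simp
    · filter_upwards [hb] with b hb
      have : ∀ p : ℝ × ℝ, ∫⁻ u in Set.Ico 0 p.1,
          (Set.Iio (0 : ℝ)).indicator (1 : ℝ → ℝ≥0∞) (sawtooth b p.2 u) = 0 := by
        intro p
        rw [setLIntegral_congr_fun measurableSet_Ico (g := fun _ => 0), lintegral_zero]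
        intro u hu
        have : 0 ≤ sawtooth b p.2 u := by
          unfold sawtooth
          split_ifs
          · exact hu.1
          · exact add_nonneg hb hu.1
        simp [this]
      simp [this]
  rw [hz, mul_zero]

theorem stationaryAge_Ioi_le {γ' : Measure ℝ} [IsProbabilityMeasure γ'] (hr : 0 < r)
    (hγ : ∀ᵐ x ∂γ, 0 ≤ x) (hγ' : ∀ᵐ x ∂γ', 0 ≤ x)
    (h0 : ∫⁻ x, ENNReal.ofReal x ∂γ ≠ 0) (htop : ∫⁻ x, ENNReal.ofReal x ∂γ ≠ ∞)
    (heq : ∫⁻ x, ENNReal.ofReal x ∂γ' = ∫⁻ x, ENNReal.ofReal x ∂γ)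
    (hcx : ConvexLE γ γ') (x : ℝ) :
    stationaryAge γ (expMeasure r) (Set.Ioi x) ≤ stationaryAge γ' (expMeasure r) (Set.Ioi x) := by
  have := isProbabilityMeasure_expMeasure hr
  have h0' : ∫⁻ x, ENNReal.ofReal x ∂γ' ≠ 0 := heq ▸ h0
  have htop' : ∫⁻ x, ENNReal.ofReal x ∂γ' ≠ ∞ := heq ▸ htop
  have hd := prod_expMeasure_deliveredSet_ne_zero hr h0
  have hd' := prod_expMeasure_deliveredSet_ne_zero hr h0'
  have := isProbabilityMeasure_stationaryAge hd h0 htop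
  have := isProbabilityMeasure_stationaryAge hd' h0' htop'
  rcases lt_or_ge x 0 with hx | hx
  -- The closed form of the tail holds for x ≥ 0 only; below 0 the right-hand tail is one because
  -- ages are non-negative.
  · have h1 : stationaryAge γ' (expMeasure r) (Set.Ioi x) = 1 := by
      rw [← Set.compl_Iic, prob_compl_eq_one_iff measurableSet_Iic]
      exact measure_mono_null (Set.Iic_subset_Iio.2 hx) (stationaryAge_Iio_zero hd' hγ')
    rw [h1]
    exact prob_le_one
  · have e1 := mul_stationaryAge_Ioi_eq_lintegral hr hγ hd h0 htop hx
    have e2 := mul_stationaryAge_Ioi_eq_lintegral hr hγ' hd' h0' htop' hx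
    have i1 := integrable_timeAboveMean hr x hcx.1
    have i2 := integrable_timeAboveMean hr x hcx.2.1
    have hle := hcx.2.2.2 _ (convexOn_timeAboveMean hr x) i1 i2
    have n1 : 0 ≤ᵐ[γ] timeAboveMean r x := by
      filter_upwards [hγ] with g hg using timeAboveMean_nonneg hr hx hg
    have n2 : 0 ≤ᵐ[γ'] timeAboveMean r x := by
      filter_upwards [hγ'] with g hg using timeAboveMean_nonneg hr hx hg
    rw [← ofReal_integral_eq_lintegral_ofReal i1 n1] at e1
    rw [← ofReal_integral_eq_lintegral_ofReal i2 n2, heq] at e2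
    rw [← ENNReal.mul_le_mul_iff_right h0 htop, e1, e2]
    exact ENNReal.ofReal_le_ofReal hle

/-- More variable interarrival times increase the age stochastically under exponential service. -/
theorem stochLE_stationaryAge {γ' : Measure ℝ} [IsProbabilityMeasure γ'] (hr : 0 < r)
    (hγ : ∀ᵐ x ∂γ, 0 ≤ x) (hγ' : ∀ᵐ x ∂γ', 0 ≤ x)
    (h0 : ∫⁻ x, ENNReal.ofReal x ∂γ ≠ 0) (htop : ∫⁻ x, ENNReal.ofReal x ∂γ ≠ ∞)
    (heq : ∫⁻ x, ENNReal.ofReal x ∂γ' = ∫⁻ x, ENNReal.ofReal x ∂γ) (hcx : ConvexLE γ γ') :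
    StochLE (stationaryAge γ (expMeasure r)) (stationaryAge γ' (expMeasure r)) := by
  have := isProbabilityMeasure_expMeasure hr
  have h0' : ∫⁻ x, ENNReal.ofReal x ∂γ' ≠ 0 := heq ▸ h0
  have := isProbabilityMeasure_stationaryAge (prod_expMeasure_deliveredSet_ne_zero hr h0) h0 htop
  have := isProbabilityMeasure_stationaryAge (prod_expMeasure_deliveredSet_ne_zero hr h0') h0'
    (heq ▸ htop)
  refine stochLE_of_measure_Iic_le fun x => ?_
  rw [← Set.compl_Ioi, prob_compl_eq_one_sub measurableSet_Ioi,
    prob_compl_eq_one_sub measurableSet_Ioi]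
  exact tsub_le_tsub_left (stationaryAge_Ioi_le hr hγ hγ' h0 htop heq hcx x) 1

end ExponentialServiceOrder

/-! ### The comparison theorem -/

theorem eq_of_lintegral_expMeasure_eq {r s : ℝ} (hr : 0 < r) (hs : 0 < s)
    (h : ∫⁻ x, ENNReal.ofReal x ∂expMeasure r = ∫⁻ x, ENNReal.ofReal x ∂expMeasure s) : r = s := by
  rw [lintegral_ofReal_expMeasure hr, lintegral_ofReal_expMeasure hs,
    ENNReal.ofReal_eq_ofReal_iff (by positivity) (by positivity)] at h
  exact inv_injective h

theorem PreemptiveLCFS.lintegral_H_eq {Ω : Type*} [MeasurableSpace Ω] {P : Measure Ω}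
    {γ η : Measure ℝ} (Q : PreemptiveLCFS P γ η) :
    ∫⁻ x, ENNReal.ofReal x ∂η = ENNReal.ofReal (∫ x, x ∂η) :=
  (ofReal_integral_eq_lintegral_ofReal Q.integrable_H Q.nonneg_H).symm

theorem corollary11
    {Ω₁ Ω₂ : Type*} [MeasurableSpace Ω₁] [MeasurableSpace Ω₂]
    (P₁ : Measure Ω₁) (P₂ : Measure Ω₂) [IsProbabilityMeasure P₁] [IsProbabilityMeasure P₂]
    (γ₁ γ₂ η₁ η₂ : Measure ℝ)
    (Q₁ : PreemptiveLCFS P₁ γ₁ η₁) (Q₂ : PreemptiveLCFS P₂ γ₂ η₂)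
    (hG : ∫ x, x ∂γ₁ = ∫ x, x ∂γ₂) (hH : ∫ x, x ∂η₁ = ∫ x, x ∂η₂) :
    (IsExponential γ₁ → IsExponential γ₂ → ConvexLE η₁ η₂ →
      (∃ ν₁, Q₁.IsStationaryAoI ν₁) ∧ (∃ ν₂, Q₂.IsStationaryAoI ν₂) ∧
      ∀ ν₁ ν₂ : Measure ℝ, Q₁.IsStationaryAoI ν₁ → Q₂.IsStationaryAoI ν₂ →
        Integrable (fun x : ℝ => x) ν₁ ∧ Integrable (fun x : ℝ => x) ν₂ ∧
          ∫ x, x ∂ν₂ ≤ ∫ x, x ∂ν₁) ∧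
    (IsExponential η₁ → IsExponential η₂ → ConvexLE γ₁ γ₂ →
      (∃ ν₁, Q₁.IsStationaryAoI ν₁) ∧ (∃ ν₂, Q₂.IsStationaryAoI ν₂) ∧
      ∀ ν₁ ν₂ : Measure ℝ, Q₁.IsStationaryAoI ν₁ → Q₂.IsStationaryAoI ν₂ → StochLE ν₁ ν₂) := by
  have := Q₁.isProbabilityMeasure_interarrival
  have := Q₂.isProbabilityMeasure_interarrival
  have := Q₁.isProbabilityMeasure_service
  have := Q₂.isProbabilityMeasure_service
  have hGeq : ∫⁻ x, ENNReal.ofReal x ∂γ₂ = ∫⁻ x, ENNReal.ofReal x ∂γ₁ := by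
    rw [Q₁.lintegral_G_eq, Q₂.lintegral_G_eq, hG]
  have hHeq : ∫⁻ x, ENNReal.ofReal x ∂η₂ = ∫⁻ x, ENNReal.ofReal x ∂η₁ := by
    rw [Q₁.lintegral_H_eq, Q₂.lintegral_H_eq, hH]
  have hγ₁ := Q₁.nonneg_G
  have hγ₂ := Q₂.nonneg_G
  have hη₁ := Q₁.nonneg_H
  have hη₂ := Q₂.nonneg_H
  constructor
  · rintro ⟨r, hr, rfl⟩ ⟨s, hs, rfl⟩ hcx
    -- Equal means force the two exponential rates to coincide, so a single r serves both queues.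
    obtain rfl := eq_of_lintegral_expMeasure_eq hs hr hGeq
    have st₁ := Q₁.isStationaryAoI_stationaryAge (expMeasure_prod_deliveredSet_ne_zero hr hη₁)
    have st₂ := Q₂.isStationaryAoI_stationaryAge (expMeasure_prod_deliveredSet_ne_zero hr hη₂)
    refine ⟨⟨_, st₁⟩, ⟨_, st₂⟩, fun ν₁ ν₂ h₁ h₂ => ?_⟩
    obtain rfl := h₁.eq st₁
    obtain rfl := h₂.eq st₂
    exact ⟨(mean_stationaryAge_expMeasure hr hη₁ hγ₁).1,
      (mean_stationaryAge_expMeasure hr hη₂ hγ₁).1, mean_stationaryAge_anti hr hη₁ hη₂ hγ₁ hcx⟩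
  · rintro ⟨r, hr, rfl⟩ ⟨s, hs, rfl⟩ hcx
    obtain rfl := eq_of_lintegral_expMeasure_eq hs hr hHeq
    have h0 : ∫⁻ x, ENNReal.ofReal x ∂γ₁ ≠ 0 := by
      rw [Q₁.lintegral_G_eq]
      exact (ENNReal.ofReal_pos.2 Q₁.mean_G_pos).ne'
    have st₁ := Q₁.isStationaryAoI_stationaryAge (prod_expMeasure_deliveredSet_ne_zero hr h0)
    have st₂ := Q₂.isStationaryAoI_stationaryAge
      (prod_expMeasure_deliveredSet_ne_zero hr (hGeq ▸ h0))
    refine ⟨⟨_, st₁⟩, ⟨_, st₂⟩, fun ν₁ ν₂ h₁ h₂ => ?_⟩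
    obtain rfl := h₁.eq st₁
    obtain rfl := h₂.eq st₂
    exact stochLE_stationaryAge hr hγ₁ hγ₂ h0 Q₁.lintegral_G_ne_top hGeq hcx
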